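/- Let $V$ be a finite-dimensional rational vector space, $n\ge 0$ an integer, and $Q:V\times V\to\mathbb{Q}$ a nondegenerate bilinear form with $Q(u,v)=(-1)^nQ(v,u)$. Fix Hodge numbers $\mathbf h=(h^{p,q})_{p+q=n}$, $0\le p\le n$, let $D=D_{\mathbf h,Q}$ be the period domain of weight $n$, $Q$-polarized Hodge structures on $V$ with Hodge numbers $\mathbf h$, and let $\check D$ be its compact dual: the set of decreasing filtrations $V_{\mathbb C}=F^0\supseteq F^1\supseteq\cdots$ with $\dim F^p=\sum_{r\ge p}h^{r,n-r}$ and $Q(F^p,F^{q})=0$ for $p+q=n+1$. Put $G=\mathrm{Aut}(V_{\mathbb R},Q)$ and $\mathfrak g_{\mathbb R}=\mathrm{End}(V_{\mathbb R},Q)$. For a nilpotent $N$ let $W(N)$ be its Jacobson–Morosov filtration: the unique finite increasing filtration with $N\,W_\ell(N)\subset W_{\ell-2}(N)$ such that $N^\ell:W^{\mathrm{gr}}_\ell(N)\to W^{\mathrm{gr}}_{-\ell}(N)$ is an isomorphism for all $\ell\ge0$. A polarized mixed Hodge structure (PMHS) $(F,N)$ on $D$ consists of $F\in\check D$ and $N\in\mathfrak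 g_{\mathbb R}$ with $N^{n+1}=0$ and $N(F^p)\subset F^{p-1}$ for all $p$ such that, with $W_\ell=W_{\ell-n}(N)$, the filtration $F$ induces a Hodge structure of weight $\ell$ on $W_\ell/W_{\ell-1}$ for every $\ell$, and the weight $n+\ell$ Hodge structure it induces on $\ker\{N^{\ell+1}:W^{\mathrm{gr}}_{n+\ell}\to W^{\mathrm{gr}}_{n-\ell-2}\}$ is polarized by $Q(\cdot,N^\ell\cdot)$ for every $\ell\ge0$. Let $$I^{p,q}=F^p\cap W_{p+q}\cap\Big(\overline{F^q}\cap W_{p+q}+\sum_{j\ge0}\overline{F^{q-1-j}}\cap W_{p+q-2-j}\Big)$$ (complexified $W$) be the summands of the Deligne splitting $V_{\mathbb C}=\bigoplus I^{p,q}$. The PMHS is $\mathbb R$-split if $\overline{I^{p,q}}=I^{q,p}$ for all $p,q$. For $p+q=n+\ell$ with $0\le\ell\le n$ set $P(N)^{p,q}=\ker\{N^{\ell+1}:I^{p,q}\to V_{\mathbb C}\}$. The primitive sub-diamond $\Diamond^{\mathrm{prim}}(F,N):\mathbb Z\times\mathbb Z\to\mathbb Z_{\ge0}$ is the function $(p,q)\mapsto\dim_{\mathbb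 C}P(N)^{p,q}$ for $n\le p+q\le 2n$, and $(p,q)\mapsto 0$ otherwise. Then the $G$-conjugacy class of an $\mathbb R$-split PMHS on $D$ is determined by its primitive sub-diamond: for any two $\mathbb R$-split PMHS $(F_1,N_1)$ and $(F_2,N_2)$ on $D$ there is a $g\in G$ with $(F_2,N_2)=(g\cdot F_1,\mathrm{Ad}_g N_1)$ if and only if $\Diamond^{\mathrm{prim}}(F_1,N_1)=\Diamond^{\mathrm{prim}}(F_2,N_2)$. -/

import Mathlib

open scoped TensorProduct

noncomputable section

namespace HodgeDiamond

universe u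

section Complexification

variable {U : Type u} [AddCommGroup U] [Module ℝ U]

/-- The complexification `U_ℂ = ℂ ⊗ U` of a real vector space. -/
abbrev Cx (U : Type u) [AddCommGroup U] [Module ℝ U] : Type u := ℂ ⊗[ℝ] U

/-- Complex conjugation `z ⊗ u ↦ z̄ ⊗ u` on `U_ℂ`, a conjugate-linear map. -/
def conjCx (U : Type u) [AddCommGroup U] [Module ℝ U] : Cx U →ₛₗ[starRingEnd ℂ] Cx U where
  toFun := (Complex.conjAe.toLinearMap).rTensor U
  map_add' := map_add _
  map_smul' c x := by
    induction x using TensorProduct.induction_on with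
    | zero => simp
    | tmul z v => simp [TensorProduct.smul_tmul']
    | add x y hx hy => simp only [smul_add, map_add, hx, hy]

/-- The complex conjugate of a complex subspace of `U_ℂ`. -/
def conjSub (E : Submodule ℂ (Cx U)) : Submodule ℂ (Cx U) := E.map (conjCx U)

end Complexification

section HodgeStructures

variable {H : Type u} [AddCommGroup H] [Module ℝ H]

/-- `Φ` is the Hodge filtration of an (effective) pure real Hodge structure of weight `w` on `H`:
a decreasing filtration with `Φ⁰ = H_ℂ` and `H_ℂ = Φᵏ ⊕ conj Φ^(w+1-k)` for all `k`
(the case `k = w + 1` gives `Φ^(w+1) = 0`). -/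
structure IsHodgeStructure (w : ℤ) (Φ : ℤ → Submodule ℂ (Cx H)) : Prop where
  antitone : Antitone Φ
  zero_eq_top : Φ 0 = ⊤
  opposed : ∀ k : ℤ, IsCompl (Φ k) (conjSub (Φ (w + 1 - k)))

/-- The Hodge component `Φᵖ ∩ conj Φ^q` of a filtration. -/
def hodgeComponent (Φ : ℤ → Submodule ℂ (Cx H)) (p q : ℤ) : Submodule ℂ (Cx H) :=
  Φ p ⊓ conjSub (Φ q)

/-- `Φ` is a weight `w` Hodge structure polarized by the real bilinear form `B`: the two
Hodge--Riemann bilinear relations hold. -/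
structure IsPolarizedHodgeStructure (w : ℤ) (B : LinearMap.BilinForm ℝ H)
    (Φ : ℤ → Submodule ℂ (Cx H)) : Prop where
  isHodgeStructure : IsHodgeStructure w Φ
  riemann_orthogonal : ∀ p q r s : ℤ, p + q = w → r + s = w → (p, q) ≠ (s, r) →
    ∀ x ∈ hodgeComponent Φ p q, ∀ y ∈ hodgeComponent Φ r s, B.baseChange ℂ x y = 0
  riemann_positive : ∀ p q : ℤ, p + q = w → ∀ x ∈ hodgeComponent Φ p q, x ≠ 0 →
    (Complex.I ^ (p - q) * B.baseChange ℂ x (conjCx H x)).im = 0 ∧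
      0 < (Complex.I ^ (p - q) * B.baseChange ℂ x (conjCx H x)).re

end HodgeStructures

section MixedHodgeStructures

variable {U : Type u} [AddCommGroup U] [Module ℝ U]

/-- The graded quotient `W_ℓ / W_(ℓ-1)` of an increasing filtration. -/
abbrev Gr (W : ℤ → Submodule ℝ U) (l : ℤ) : Type u :=
  (W l) ⧸ ((W (l - 1)).comap (W l).subtype)

/-- The projection `W_ℓ → W_ℓ / W_(ℓ-1)`. -/
abbrev grMk (W : ℤ → Submodule ℝ U) (l : ℤ) : W l →ₗ[ℝ] Gr W l :=
  ((W (l - 1)).comap (W l).subtype).mkQ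

/-- The filtration induced by `F` on the complexified graded quotient: the image of
`Fᵖ ∩ W_(ℓ,ℂ)` under `W_(ℓ,ℂ) → (W_ℓ / W_(ℓ-1))_ℂ`. -/
def grFiltration (W : ℤ → Submodule ℝ U) (F : ℤ → Submodule ℂ (Cx U)) (l : ℤ) :
    ℤ → Submodule ℂ (Cx (Gr W l)) := fun p =>
  ((F p).comap ((W l).subtype.baseChange ℂ)).map ((grMk W l).baseChange ℂ)

/-- `(W, F)` is a mixed Hodge structure on the real vector space `U`: finite filtrations,
`W` increasing and `F` decreasing, such that `F` induces a Hodge structure of weight `ℓ` on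
`W_ℓ / W_(ℓ-1)` for all `ℓ`. -/
structure IsMHS (W : ℤ → Submodule ℝ U) (F : ℤ → Submodule ℂ (Cx U)) : Prop where
  monotone : Monotone W
  exists_eq_bot : ∃ a, W a = ⊥
  exists_eq_top : ∃ b, W b = ⊤
  antitone : Antitone F
  exists_F_eq_top : ∃ a, F a = ⊤
  exists_F_eq_bot : ∃ b, F b = ⊥
  graded : ∀ l : ℤ, IsHodgeStructure l (grFiltration W F l)

/-- The subspace `U^a_b = ∑_(j ≥ 0) F^(a-j) ∩ W_(b-j)` of `U_ℂ`. -/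
def deligneU (W : ℤ → Submodule ℝ U) (F : ℤ → Submodule ℂ (Cx U)) (a b : ℤ) :
    Submodule ℂ (Cx U) :=
  ⨆ j : ℕ, F (a - j) ⊓ (W (b - j)).baseChange ℂ

/-- The component `I^(p,q)` of the Deligne splitting of `(W, F)`, by Deligne's formula. -/
def deligneI (W : ℤ → Submodule ℝ U) (F : ℤ → Submodule ℂ (Cx U)) (p q : ℤ) :
    Submodule ℂ (Cx U) :=
  F p ⊓ (W (p + q)).baseChange ℂ ⊓
    (conjSub (F q) ⊓ (W (p + q)).baseChange ℂ ⊔ conjSub (deligneU W F (q - 1) (p + q - 2)))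

/-- `(W, F)` is `ℝ`-split: `conj I^(p,q) = I^(q,p)`. -/
def IsRSplit (W : ℤ → Submodule ℝ U) (F : ℤ → Submodule ℂ (Cx U)) : Prop :=
  ∀ p q : ℤ, conjSub (deligneI W F p q) = deligneI W F q p

end MixedHodgeStructures

section Polarizations

variable {U : Type u} [AddCommGroup U] [Module ℝ U]

/-- The group `Aut(U, Q)` of linear automorphisms preserving `Q`. -/
def autGroup (Q : LinearMap.BilinForm ℝ U) : Subgroup (U ≃ₗ[ℝ] U) where
  carrier := {g | ∀ u v, Q (g u) (g v) = Q u v}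
  mul_mem' := by
    intro a b ha hb u v
    rw [LinearEquiv.mul_apply, LinearEquiv.mul_apply, ha, hb]
  one_mem' := by intro u v; rfl
  inv_mem' := by
    intro a ha u v
    have h := ha (a⁻¹ u) (a⁻¹ v)
    rw [← LinearEquiv.mul_apply, ← LinearEquiv.mul_apply, mul_inv_cancel] at h
    exact h.symm

/-- `W` is the Jacobson--Morosov (monodromy weight) filtration `W(N)` of `N`: the finite
increasing filtration with `N W_ℓ ⊆ W_(ℓ-2)` such that the map
`W_ℓ / W_(ℓ-1) → W_(-ℓ) / W_(-ℓ-1)` induced by `N^ℓ` is injective and surjective for `ℓ ≥ 0`. -/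
structure IsJacobsonMorosov (N : Module.End ℝ U) (W : ℤ → Submodule ℝ U) : Prop where
  monotone : Monotone W
  exists_eq_bot : ∃ a, W a = ⊥
  exists_eq_top : ∃ b, W b = ⊤
  shift : ∀ l : ℤ, ∀ u ∈ W l, N u ∈ W (l - 2)
  injective : ∀ l : ℕ, ∀ u ∈ W l, (N ^ l) u ∈ W (-(l : ℤ) - 1) → u ∈ W ((l : ℤ) - 1)
  surjective : ∀ l : ℕ, ∀ v ∈ W (-(l : ℤ)), ∃ u ∈ W l, v - (N ^ l) u ∈ W (-(l : ℤ) - 1)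

/-- The data `(W, F, N)` underlying a polarized mixed Hodge structure: a real filtration `W`, a
complex filtration `F`, and a real endomorphism `N`. -/
@[ext]
structure Triple (U : Type u) [AddCommGroup U] [Module ℝ U] where
  W : ℤ → Submodule ℝ U
  F : ℤ → Submodule ℂ (Cx U)
  N : Module.End ℝ U

namespace Triple

/-- The translate `g · (W, F, N) = (g W, g F, Ad_g N)`. -/
def translate (g : U ≃ₗ[ℝ] U) (X : Triple U) : Triple U where
  W l := (X.W l).map g.toLinearMap
  F p := (X.F p).map (g.toLinearMap.baseChange ℂ)
  N := g.toLinearMap ∘ₗ X.N ∘ₗ g.symm.toLinearMap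

/-- The primitive space `P(N)_ℓ`, the kernel of the map
`W_(n+ℓ) / W_(n+ℓ-1) → W_(n-ℓ-2) / W_(n-ℓ-3)` induced by `N^(ℓ+1)`: the classes of the
`u ∈ W_(n+ℓ)` with `N^(ℓ+1) u ∈ W_(n-ℓ-3)`. -/
def primGr (n : ℕ) (X : Triple U) (l : ℕ) : Submodule ℝ (Gr X.W (n + l)) :=
  ((X.W ((n : ℤ) - l - 3)).comap ((X.N ^ (l + 1)) ∘ₗ (X.W (n + l)).subtype)).map
    (grMk X.W (n + l))

/-- The filtration induced by `F` on `P(N)_ℓ`. -/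
def primFiltration (n : ℕ) (X : Triple U) (l : ℕ) :
    ℤ → Submodule ℂ (Cx (X.primGr n l)) := fun p =>
  (grFiltration X.W X.F (n + l) p).comap ((X.primGr n l).subtype.baseChange ℂ)

/-- `B` is the bilinear form `Q(·, N^ℓ ·)` on `P(N)_ℓ`, computed on representatives. It is
unique, since every class has a representative. -/
def IsPrimForm (n : ℕ) (Q : LinearMap.BilinForm ℝ U) (X : Triple U) (l : ℕ)
    (B : LinearMap.BilinForm ℝ (X.primGr n l)) : Prop :=
  ∀ (x y : X.primGr n l) (u v : X.W (n + l)),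
    grMk X.W (n + l) u = x → grMk X.W (n + l) v = y →
      B x y = Q (u : U) ((X.N ^ l) (v : U))

/-- `(W, F, N)` is a `Q`-polarized mixed Hodge structure of weight `n` on `U`. -/
structure IsPMHS (n : ℕ) (Q : LinearMap.BilinForm ℝ U) (X : Triple U) : Prop where
  isMHS : IsMHS X.W X.F
  mem_lieAlgebra : ∀ u v, Q (X.N u) v + Q u (X.N v) = 0
  nilpotent : X.N ^ (n + 1) = 0
  /-- `W = W(N)[-n]` -/
  weight : IsJacobsonMorosov X.N (fun l => X.W (l + n))
  isotropic : ∀ p q : ℤ, p + q = n + 1 → ∀ x ∈ X.F p, ∀ y ∈ X.F q, Q.baseChange ℂ x y = 0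
  horizontal : ∀ p : ℤ, ∀ x ∈ X.F p, X.N.baseChange ℂ x ∈ X.F (p - 1)
  polarized : ∀ l : ℕ, ∃ B : LinearMap.BilinForm ℝ (X.primGr n l),
    X.IsPrimForm n Q l B ∧ IsPolarizedHodgeStructure (n + l) B (X.primFiltration n l)

end Triple

/-- `F` is a point of the compact dual of the period domain of weight `n` `Q`-polarized Hodge
structures with Hodge numbers `h^(p,q)` (`p + q = n`, `0 ≤ p ≤ n`): a `Q`-isotropic filtration
`U_ℂ = F⁰ ⊇ F¹ ⊇ ⋯` with `dim Fᵖ = ∑_(r ≥ p) h^(r,n-r)`. -/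
structure IsCompactDualPoint (n : ℕ) (Q : LinearMap.BilinForm ℝ U) (h : ℤ → ℤ → ℕ)
    (F : ℤ → Submodule ℂ (Cx U)) : Prop where
  antitone : Antitone F
  zero_eq_top : F 0 = ⊤
  finrank_eq : ∀ p : ℤ, 0 ≤ p → Module.finrank ℂ (F p) = ∑ r ∈ Finset.Icc p (n : ℤ), h r (n - r)
  isotropic : ∀ p q : ℤ, p + q = n + 1 → ∀ x ∈ F p, ∀ y ∈ F q, Q.baseChange ℂ x y = 0

namespace Triple

/-- `(W, F, N)` is an `ℝ`-split polarized mixed Hodge structure on the period domain of weight `n`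
`Q`-polarized Hodge structures with Hodge numbers `h`. -/
structure IsRSplitPMHSOn (n : ℕ) (Q : LinearMap.BilinForm ℝ U) (h : ℤ → ℤ → ℕ)
    (X : Triple U) : Prop where
  isPMHS : X.IsPMHS n Q
  mem_compactDual : IsCompactDualPoint n Q h X.F
  isRSplit : IsRSplit X.W X.F

/-- The primitive subspace `P(N)^(p,q) = I^(p,q) ∩ ker N^(ℓ+1)`, where `p + q = n + ℓ`. -/
def prim (X : Triple U) (l : ℕ) (p q : ℤ) : Submodule ℂ (Cx U) :=
  deligneI X.W X.F p q ⊓ LinearMap.ker ((X.N ^ (l + 1)).baseChange ℂ)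

/-- The weight `n + ℓ` primitive part of the Hodge diamond: `(p, q) ↦ dim P(N)^(p,q)` on the line
`p + q = n + ℓ`, and zero off that line. -/
def primPart (n : ℕ) (X : Triple U) (l : ℕ) (p q : ℤ) : ℕ :=
  if p + q = n + l then Module.finrank ℂ (X.prim l p q) else 0

/-- The primitive sub-diamond, the sum of the primitive parts of weights `n + ℓ`, `0 ≤ ℓ ≤ n`. -/
def primDiamond (n : ℕ) (X : Triple U) (p q : ℤ) : ℕ :=
  ∑ l ∈ Finset.range (n + 1), X.primPart n l p q

end Triple

end Polarizations

end HodgeDiamond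

end

/-!
An `ℝ`-split PMHS is determined up to conjugation by the dimensions of its primitive spaces because
it is assembled from them in a rigid way. For an `ℝ`-split mixed Hodge structure Deligne's formula
reduces to `I^(p,q) = Fᵖ ∩ conj F^q ∩ W_(p+q)` (`IsRSplit.deligneI_eq`), and Deligne's lifting
argument (`IsMHS.filtration_inf_le`) shows that the `I^(p,q)` span `F` and `W`. The Lefschetz
isomorphisms `N^ℓ : I^(p,q) ≃ I^(p-ℓ,q-ℓ)`, `p + q = n + ℓ`, follow from the defining property of
`W(N)` and strictness, and give `U_ℂ = ∑ N^j P^(p,q)` (`Triple.IsPMHS.deligneI_le`).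

Isotropy of `F` and `conj F`, together with the skewness of `N`, forces `N^j P^(p,q)` and
`N^k P^(r,s)` to be `Q`-orthogonal unless `(r,s) = (q,p)` and `j + k = ℓ`
(`Triple.IsPMHS.dual_of_bilin_ne_zero`), and on `P^(p,q)` the form `i^(p-q) Q(x, N^ℓ conj y)` is
Hermitian and positive definite (`Triple.IsPMHS.hodgeForm_pos`). One can therefore choose
orthonormal bases of the `P^(p,q)` that are exchanged by conjugation, real ones when `p = q`
(`Triple.IsPMHS.exists_isAdaptedFrame`). Applying powers of `N` yields a basis of `U_ℂ` on which
conjugation, `N` and `Q` are given by formulas involving only the indices. If two PMHS have the same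
primitive dimensions, then the map matching these bases is defined over `ℝ`, lies in `Aut(U, Q)`,
and carries one PMHS to the other (`Triple.exists_eq_translate`). The converse is transport of
structure (`Triple.finrank_prim_translate`).
-/

namespace HodgeDiamond

universe u

/-! ### Real and imaginary parts in a complexification -/

section Complexification

variable {U U' : Type u} [AddCommGroup U] [Module ℝ U] [AddCommGroup U'] [Module ℝ U']

/-- The real part `U_ℂ → U` with respect to the real structure `1 ⊗ U`. -/
noncomputable def reCx (U : Type u) [AddCommGroup U] [Module ℝ U] : Cx U →ₗ[ℝ] U :=
  (TensorProduct.lid ℝ U).toLinearMap ∘ₗ Complex.reLm.rTensor U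

/-- The imaginary part `U_ℂ → U` with respect to the real structure `1 ⊗ U`. -/
noncomputable def imCx (U : Type u) [AddCommGroup U] [Module ℝ U] : Cx U →ₗ[ℝ] U :=
  (TensorProduct.lid ℝ U).toLinearMap ∘ₗ Complex.imLm.rTensor U

@[simp] theorem reCx_tmul (z : ℂ) (u : U) : reCx U (z ⊗ₜ u) = z.re • u := by simp [reCx]

@[simp] theorem imCx_tmul (z : ℂ) (u : U) : imCx U (z ⊗ₜ u) = z.im • u := by simp [imCx]

@[simp] theorem conjCx_tmul (z : ℂ) (u : U) :
    conjCx U (z ⊗ₜ u) = (starRingEnd ℂ z) ⊗ₜ u := rfl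

theorem re_add_im_cx (x : Cx U) : (1 : ℂ) ⊗ₜ[ℝ] reCx U x + Complex.I ⊗ₜ[ℝ] imCx U x = x := by
  induction x using TensorProduct.induction_on with
  | zero => simp
  | tmul z u =>
    simp only [reCx_tmul, imCx_tmul, ← TensorProduct.smul_tmul, ← TensorProduct.add_tmul]
    congr 1
    apply Complex.ext <;> simp
  | add x y hx hy =>
    conv_rhs => rw [← hx, ← hy]
    simp only [map_add, TensorProduct.tmul_add]
    abel

@[simp] theorem conjCx_conjCx (x : Cx U) : conjCx U (conjCx U x) = x := by
  induction x using TensorProduct.induction_on with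
  | zero => simp
  | tmul z u => simp
  | add x y hx hy => simp [hx, hy]

theorem conjCx_injective : Function.Injective (conjCx U) := fun x y h => by
  rw [← conjCx_conjCx x, h, conjCx_conjCx]

theorem conjCx_eq (x : Cx U) :
    conjCx U x = (1 : ℂ) ⊗ₜ[ℝ] reCx U x - Complex.I ⊗ₜ[ℝ] imCx U x := by
  conv_lhs => rw [← re_add_im_cx x]
  simp [TensorProduct.neg_tmul, sub_eq_add_neg]

theorem imCx_conjCx (x : Cx U) : imCx U (conjCx U x) = -imCx U x := by
  rw [conjCx_eq]; simp

theorem reCx_conjCx (x : Cx U) : reCx U (conjCx U x) = reCx U x := by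
  rw [conjCx_eq]; simp

theorem one_tmul_reCx_of_conjCx_eq {x : Cx U} (h : conjCx U x = x) :
    (1 : ℂ) ⊗ₜ[ℝ] reCx U x = x := by
  have h1 := imCx_conjCx x
  rw [h] at h1
  have h2 : imCx U x = 0 := by
    have h3 : (2 : ℝ) • imCx U x = 0 := by rw [two_smul, ← sub_neg_eq_add, ← h1, sub_self]
    simpa using h3
  conv_rhs => rw [← re_add_im_cx x, h2]
  simp

@[simp] theorem conjCx_baseChange (f : U →ₗ[ℝ] U') (x : Cx U) :
    conjCx U' (f.baseChange ℂ x) = f.baseChange ℂ (conjCx U x) := by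
  induction x using TensorProduct.induction_on with
  | zero => simp
  | tmul z u => simp
  | add x y hx hy => simp [hx, hy]

@[simp] theorem reCx_baseChange (f : U →ₗ[ℝ] U') (x : Cx U) :
    reCx U' (f.baseChange ℂ x) = f (reCx U x) := by
  induction x using TensorProduct.induction_on with
  | zero => simp
  | tmul z u => simp
  | add x y hx hy => simp [hx, hy]

@[simp] theorem imCx_baseChange (f : U →ₗ[ℝ] U') (x : Cx U) :
    imCx U' (f.baseChange ℂ x) = f (imCx U x) := by
  induction x using TensorProduct.induction_on with
  | zero => simp
  | tmul z u => simp
  | add x y hx hy => simp [hx, hy]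

theorem mem_conjSub {E : Submodule ℂ (Cx U)} {x : Cx U} : x ∈ conjSub E ↔ conjCx U x ∈ E := by
  constructor
  · rintro ⟨y, hy, rfl⟩
    simpa using hy
  · intro h
    exact ⟨_, h, conjCx_conjCx x⟩

theorem conjSub_mono {E E' : Submodule ℂ (Cx U)} (h : E ≤ E') : conjSub E ≤ conjSub E' :=
  fun _ hx => mem_conjSub.2 (h (mem_conjSub.1 hx))

theorem cx_eq_zero_iff {x : Cx U} : x = 0 ↔ reCx U x = 0 ∧ imCx U x = 0 := by
  constructor
  · rintro rfl; simp
  · rintro ⟨h1, h2⟩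
    rw [← re_add_im_cx x, h1, h2]; simp

theorem mem_baseChange_iff {S : Submodule ℝ U} {x : Cx U} :
    x ∈ S.baseChange ℂ ↔ reCx U x ∈ S ∧ imCx U x ∈ S := by
  constructor
  · rintro ⟨y, rfl⟩
    simp
  · rintro ⟨h1, h2⟩
    rw [← re_add_im_cx x]
    exact add_mem (Submodule.tmul_mem_baseChange_of_mem _ h1)
      (Submodule.tmul_mem_baseChange_of_mem _ h2)

theorem one_tmul_mem_baseChange_iff {S : Submodule ℝ U} {u : U} :
    (1 : ℂ) ⊗ₜ[ℝ] u ∈ S.baseChange ℂ ↔ u ∈ S := by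
  simp [mem_baseChange_iff]

theorem conjCx_mem_baseChange {S : Submodule ℝ U} {x : Cx U} :
    conjCx U x ∈ S.baseChange ℂ ↔ x ∈ S.baseChange ℂ := by
  simp [mem_baseChange_iff, reCx_conjCx, imCx_conjCx]

theorem conjCx_bilin (B : LinearMap.BilinForm ℝ U) (x y : Cx U) :
    B.baseChange ℂ (conjCx U x) (conjCx U y) = starRingEnd ℂ (B.baseChange ℂ x y) := by
  induction x using TensorProduct.induction_on with
  | zero => simp
  | add x x' hx hx' => simp [hx, hx']
  | tmul z u =>
    induction y using TensorProduct.induction_on with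
    | zero => simp
    | tmul z' u' => simp
    | add y y' hy hy' => simp only [map_add, hy, hy']

theorem bilin_baseChange_congr {B : LinearMap.BilinForm ℝ U} {B' : LinearMap.BilinForm ℝ U'}
    {f g : U →ₗ[ℝ] U'} (h : ∀ u v, B u v = B' (f u) (g v)) (x y : Cx U) :
    B.baseChange ℂ x y = B'.baseChange ℂ (f.baseChange ℂ x) (g.baseChange ℂ y) := by
  induction x using TensorProduct.induction_on with
  | zero => simp
  | add x x' hx hx' => simp [hx, hx']
  | tmul z u =>
    induction y using TensorProduct.induction_on with
    | zero => simp
    | tmul z' u' => simp [h]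
    | add y y' hy hy' => simp only [map_add, hy, hy']

theorem bilin_baseChange_skew {B : LinearMap.BilinForm ℝ U} {N : Module.End ℝ U}
    (h : ∀ u v, B (N u) v + B u (N v) = 0) (x y : Cx U) :
    B.baseChange ℂ (N.baseChange ℂ x) y = -B.baseChange ℂ x (N.baseChange ℂ y) := by
  induction x using TensorProduct.induction_on with
  | zero => simp
  | add x x' hx hx' => simp [hx, hx']; ring
  | tmul z u =>
    induction y using TensorProduct.induction_on with
    | zero => simp
    | tmul z' u' => simp [eq_neg_of_add_eq_zero_left (h u u')]
    | add y y' hy hy' => simp only [map_add, hy, hy']; ring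

theorem bilin_baseChange_symm {B : LinearMap.BilinForm ℝ U} {n : ℕ}
    (h : ∀ u v, B u v = (-1) ^ n * B v u) (x y : Cx U) :
    B.baseChange ℂ x y = (-1) ^ n * B.baseChange ℂ y x := by
  induction x using TensorProduct.induction_on with
  | zero => simp
  | add x x' hx hx' => simp [hx, hx']; ring
  | tmul z u =>
    induction y using TensorProduct.induction_on with
    | zero => simp
    | tmul z' u' =>
      simp only [LinearMap.BilinForm.baseChange_tmul, h u u', Complex.real_smul]
      push_cast; ring
    | add y y' hy hy' => simp only [map_add, LinearMap.add_apply, hy, hy']; ring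

end Complexification

/-! ### The Deligne splitting of an `ℝ`-split mixed Hodge structure -/

section MixedHodgeStructures

variable {U : Type u} [AddCommGroup U] [Module ℝ U]
  {W : ℤ → Submodule ℝ U} {F : ℤ → Submodule ℂ (Cx U)}

theorem baseChange_mono {S T : Submodule ℝ U} (h : S ≤ T) : S.baseChange ℂ ≤ T.baseChange ℂ :=
  fun _ hx => mem_baseChange_iff.2 ⟨h (mem_baseChange_iff.1 hx).1, h (mem_baseChange_iff.1 hx).2⟩

theorem mem_grFiltration {l p : ℤ} {x : Cx (Gr W l)} :
    x ∈ grFiltration W F l p ↔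
      ∃ z : Cx (W l), (W l).subtype.baseChange ℂ z ∈ F p ∧ (grMk W l).baseChange ℂ z = x :=
  Iff.rfl

theorem grMk_baseChange_eq_zero_iff {l : ℤ} {z : Cx (W l)} :
    (grMk W l).baseChange ℂ z = 0 ↔
      (W l).subtype.baseChange ℂ z ∈ (W (l - 1)).baseChange ℂ := by
  rw [cx_eq_zero_iff, mem_baseChange_iff]
  simp

theorem subtype_baseChange_mem {l : ℤ} (z : Cx (W l)) :
    (W l).subtype.baseChange ℂ z ∈ (W l).baseChange ℂ := ⟨z, rfl⟩

/-- The two filtrations `F` and `conj F` together generate the weight-graded pieces: the spanning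
half of the opposedness condition, expressed in `U_ℂ`. -/
theorem IsMHS.exists_sub_add_mem (hM : IsMHS W F) (k l : ℤ) {x : Cx U}
    (hx : x ∈ (W l).baseChange ℂ) :
    ∃ u ∈ F k ⊓ (W l).baseChange ℂ, ∃ v ∈ conjSub (F (l + 1 - k)) ⊓ (W l).baseChange ℂ,
      x - (u + v) ∈ (W (l - 1)).baseChange ℂ := by
  obtain ⟨z, rfl⟩ := hx
  have htop := ((hM.graded l).opposed k).sup_eq_top
  have hz : (grMk W l).baseChange ℂ z ∈ (⊤ : Submodule ℂ (Cx (Gr W l))) := trivial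
  rw [← htop] at hz
  obtain ⟨a, ha, b, hb, hab⟩ := Submodule.mem_sup.1 hz
  obtain ⟨za, ha1, rfl⟩ := mem_grFiltration.1 ha
  obtain ⟨zb, hb1, hb2⟩ := mem_grFiltration.1 (mem_conjSub.1 hb)
  refine ⟨_, ⟨ha1, subtype_baseChange_mem za⟩, _,
    ⟨mem_conjSub.2 ?_, subtype_baseChange_mem (conjCx _ zb)⟩, ?_⟩
  · rwa [← conjCx_baseChange, conjCx_conjCx]
  · rw [← map_add, ← map_sub]
    apply grMk_baseChange_eq_zero_iff.1
    rw [map_sub, map_add, ← conjCx_baseChange _ zb, hb2, conjCx_conjCx, hab, sub_self]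

/-- The filtrations `F` and `conj F` are independent in the weight-graded pieces: the other half
of the opposedness condition, expressed in `U_ℂ`. -/
theorem IsMHS.mem_of_sub_mem (hM : IsMHS W F) {k l : ℤ} {x y : Cx U}
    (hx : x ∈ F k) (hxW : x ∈ (W l).baseChange ℂ)
    (hy : y ∈ conjSub (F (l + 1 - k))) (hyW : y ∈ (W l).baseChange ℂ)
    (hxy : x - y ∈ (W (l - 1)).baseChange ℂ) : x ∈ (W (l - 1)).baseChange ℂ := by
  obtain ⟨z, rfl⟩ := hxW
  obtain ⟨t, rfl⟩ := hyW
  have hbot := ((hM.graded l).opposed k).inf_eq_bot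
  have hzt : (grMk W l).baseChange ℂ z = (grMk W l).baseChange ℂ t := by
    rw [← sub_eq_zero, ← map_sub]
    apply grMk_baseChange_eq_zero_iff.2
    rwa [map_sub]
  apply grMk_baseChange_eq_zero_iff.1
  rw [← Submodule.mem_bot ℂ, ← hbot]
  refine ⟨mem_grFiltration.2 ⟨z, hx, rfl⟩, mem_conjSub.2 (mem_grFiltration.2 ⟨conjCx _ t, ?_, ?_⟩)⟩
  · rw [← conjCx_baseChange]
    exact mem_conjSub.1 hy
  · rw [hzt, conjCx_baseChange]

/-- In the `ℝ`-split case the correction term in Deligne's formula is superfluous. -/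
theorem IsRSplit.deligneI_eq (hS : IsRSplit W F) (p q : ℤ) :
    deligneI W F p q = F p ⊓ conjSub (F q) ⊓ (W (p + q)).baseChange ℂ := by
  apply le_antisymm
  · intro x hx
    refine ⟨⟨hx.1.1, ?_⟩, hx.1.2⟩
    rw [← hS q p] at hx
    exact conjSub_mono (inf_le_left.trans inf_le_left) hx
  · rintro x ⟨⟨h1, h2⟩, h3⟩
    exact ⟨⟨h1, h3⟩, Submodule.mem_sup_left ⟨h2, h3⟩⟩

theorem IsRSplit.mem_deligneI (hS : IsRSplit W F) {p q : ℤ} {x : Cx U} :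
    x ∈ deligneI W F p q ↔ x ∈ F p ∧ conjCx U x ∈ F q ∧ x ∈ (W (p + q)).baseChange ℂ := by
  rw [hS.deligneI_eq, Submodule.mem_inf, Submodule.mem_inf, mem_conjSub, and_assoc]

theorem IsRSplit.conjCx_mem_deligneI (hS : IsRSplit W F) {p q : ℤ} {x : Cx U} :
    conjCx U x ∈ deligneI W F q p ↔ x ∈ deligneI W F p q := by
  rw [← hS p q, mem_conjSub, conjCx_conjCx]

/-- The component `I^(p,q)` meets `W_(p+q-1)` trivially, so that it embeds in the weight-graded
piece. -/
theorem IsMHS.eq_zero_of_mem_deligneI (hM : IsMHS W F) (hS : IsRSplit W F) {p q : ℤ} {x : Cx U}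
    (hx : x ∈ deligneI W F p q) (hxW : x ∈ (W (p + q - 1)).baseChange ℂ) : x = 0 := by
  obtain ⟨h1, h2, -⟩ := hS.mem_deligneI.1 hx
  have key : ∀ m : ℕ, x ∈ (W (p + q - 1 - m)).baseChange ℂ := by
    intro m
    induction m with
    | zero => simpa using hxW
    | succ m ih =>
      have := hM.mem_of_sub_mem (k := p) h1 ih
        (mem_conjSub.2 (hM.antitone (by omega : p + q - 1 - m + 1 - p ≤ q) h2)) ih (by simp)
      convert this using 3
      push_cast; ring
  obtain ⟨a, ha⟩ := hM.exists_eq_bot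
  have h3 := baseChange_mono (hM.monotone (by omega : p + q - 1 - ((p + q - 1 - a).toNat : ℕ) ≤ a))
    (key _)
  rw [ha] at h3
  simpa using h3

theorem le_deligneU (a b : ℤ) (j : ℕ) :
    F (a - j) ⊓ (W (b - j)).baseChange ℂ ≤ deligneU W F a b :=
  le_iSup (fun j : ℕ => F (a - j) ⊓ (W (b - j)).baseChange ℂ) j

/-- Iterating the spanning half of opposedness down the weight filtration, the part outside `Fᵖ`
collects exactly the terms of `conj U^(m+1-p)_m`. -/
theorem IsMHS.baseChange_le_sup_deligneU (hM : IsMHS W F) (p m : ℤ) :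
    (W m).baseChange ℂ ≤ (F p ⊓ (W m).baseChange ℂ) ⊔ conjSub (deligneU W F (m + 1 - p) m) := by
  have key : ∀ j : ℕ, (W m).baseChange ℂ ≤ (F p ⊓ (W m).baseChange ℂ) ⊔
      conjSub (deligneU W F (m + 1 - p) m) ⊔ (W (m - j)).baseChange ℂ := by
    intro j
    induction j with
    | zero => simp
    | succ j ih =>
      refine ih.trans (sup_le le_sup_left ?_)
      intro x hx
      obtain ⟨u, hu, v, hv, h⟩ := hM.exists_sub_add_mem p (m - j) hx
      have e : x = u + v + (x - (u + v)) := by abel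
      rw [e]
      refine add_mem (Submodule.mem_sup_left (add_mem (Submodule.mem_sup_left ⟨hu.1, ?_⟩)
        (Submodule.mem_sup_right ?_))) (Submodule.mem_sup_right ?_)
      · exact baseChange_mono (hM.monotone (by omega)) hu.2
      · apply mem_conjSub.2
        apply le_deligneU _ _ j
        refine ⟨?_, conjCx_mem_baseChange.2 hv.2⟩
        have := mem_conjSub.1 hv.1
        rwa [show (m - j + 1 - p : ℤ) = m + 1 - p - j by ring] at this
      · convert h using 3
        push_cast; ring
  obtain ⟨a, ha⟩ := hM.exists_eq_bot
  have h := key (m - a).toNat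
  have h2 := baseChange_mono (hM.monotone (by omega : m - ((m - a).toNat : ℕ) ≤ a))
  rw [ha] at h2
  refine h.trans (sup_le le_rfl (h2.trans ?_))
  simp

/-- Deligne's lifting argument: a class of type `(p, l - p)` in the weight `l` graded piece has a
representative in `I^(p,l-p)`. -/
theorem IsMHS.filtration_inf_le (hM : IsMHS W F) (p l : ℤ) :
    F p ⊓ (W l).baseChange ℂ ≤ (F (p + 1) ⊓ (W l).baseChange ℂ) ⊔ deligneI W F p (l - p) ⊔
      (F p ⊓ (W (l - 1)).baseChange ℂ) := by
  rintro x ⟨hx, hxW⟩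
  have hW1 : (W (l - 1)).baseChange ℂ ≤ (W l).baseChange ℂ :=
    baseChange_mono (hM.monotone (by omega))
  have hW2 : (W (l - 1 - 1)).baseChange ℂ ≤ (W (l - 1)).baseChange ℂ :=
    baseChange_mono (hM.monotone (by omega))
  obtain ⟨u, hu, v, hv, h⟩ := hM.exists_sub_add_mem (p + 1) l hxW
  obtain ⟨a, ha, b, hb, hc⟩ := hM.exists_sub_add_mem p (l - 1) h
  obtain ⟨a', ha', d, hd, had⟩ := Submodule.mem_sup.1
    (hM.baseChange_le_sup_deligneU p (l - 1 - 1) hc)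
  have hu' : u ∈ F p := hM.antitone (by omega) hu.1
  -- `x - u` is congruent to `v` modulo `W_(l-1)`; correcting both sides produces `z ∈ I^(p,l-p)`.
  have hz : x - u - a - a' ∈ deligneI W F p (l - p) := by
    have hxz : x - u - a - a' = (v + b) + d := by
      have : a' + d = x - (u + v) - (a + b) := had
      rw [← eq_sub_iff_add_eq'] at this
      rw [this]; abel
    refine ⟨⟨sub_mem (sub_mem (sub_mem hx hu') ha.1) ha'.1, ?_⟩, ?_⟩
    · rw [add_sub_cancel]
      exact sub_mem (sub_mem (sub_mem hxW hu.2) (hW1 ha.2)) (hW1 (hW2 ha'.2))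
    · rw [hxz, add_sub_cancel]
      refine add_mem (Submodule.mem_sup_left (add_mem ⟨?_, hv.2⟩ ⟨?_, hW1 hb.2⟩))
        (Submodule.mem_sup_right ?_)
      · have := hv.1
        rwa [show l + 1 - (p + 1) = l - p by ring] at this
      · have := hb.1
        rwa [show l - 1 + 1 - p = l - p by ring] at this
      · rwa [show l - 1 - 1 + 1 - p = l - p - 1 by ring, show l - 1 - 1 = l - 2 by ring] at hd
  have e : x = u + (x - u - a - a') + (a + a') := by abel
  rw [e]
  exact add_mem (add_mem (Submodule.mem_sup_left (Submodule.mem_sup_left hu))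
    (Submodule.mem_sup_left (Submodule.mem_sup_right hz)))
    (Submodule.mem_sup_right (add_mem ha ⟨ha'.1, hW2 ha'.2⟩))

/-- The components `I^(r,s)` with `r ≥ p` and `r + s ≤ l` span `Fᵖ ∩ W_l`. -/
theorem IsMHS.filtration_inf_le_of_deligneI_le (hM : IsMHS W F) {T : Submodule ℂ (Cx U)} {p l : ℤ}
    (hT : ∀ r s, p ≤ r → r + s ≤ l → deligneI W F r s ≤ T) :
    F p ⊓ (W l).baseChange ℂ ≤ T := by
  obtain ⟨a, ha⟩ := hM.exists_eq_bot
  obtain ⟨b, hb⟩ := hM.exists_F_eq_bot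
  -- Double induction: upwards on the weight `l`, downwards on the Hodge index `p`.
  have key : ∀ m k : ℕ, ∀ l p : ℤ, l ≤ a + m → b ≤ p + k →
      (∀ r s, p ≤ r → r + s ≤ l → deligneI W F r s ≤ T) → F p ⊓ (W l).baseChange ℂ ≤ T := by
    intro m
    induction m with
    | zero =>
      intro k l p hl _ _
      have h2 := baseChange_mono (hM.monotone (by simpa using hl))
      rw [ha] at h2
      exact inf_le_right.trans (h2.trans (by simp))
    | succ m ihm =>
      intro k
      induction k with
      | zero =>
        intro l p _ hp _
        have h2 := hM.antitone (by simpa using hp)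
        rw [hb] at h2
        exact inf_le_left.trans (h2.trans (by simp))
      | succ k ihk =>
        intro l p hl hp h
        refine (hM.filtration_inf_le p l).trans (sup_le (sup_le ?_ ?_) ?_)
        · exact ihk l (p + 1) hl (by push_cast at hp; omega)
            fun r s hr hs => h r s (by omega) hs
        · exact h _ _ le_rfl (by omega)
        · exact ihm (k + 1) (l - 1) p (by push_cast at hl; omega) hp
            fun r s hr hs => h r s hr (by omega)
  exact key (l - a).toNat (b - p).toNat l p (by omega) (by omega) hT

theorem IsMHS.filtration_le_of_deligneI_le (hM : IsMHS W F) {T : Submodule ℂ (Cx U)} {p : ℤ}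
    (hT : ∀ r s, p ≤ r → deligneI W F r s ≤ T) : F p ≤ T := by
  obtain ⟨b, hb⟩ := hM.exists_eq_top
  have := hM.filtration_inf_le_of_deligneI_le (l := b) fun r s hr _ => hT r s hr
  rwa [hb, Submodule.baseChange_top, inf_top_eq] at this

theorem IsMHS.baseChange_le_of_deligneI_le (hM : IsMHS W F) {T : Submodule ℂ (Cx U)} {l : ℤ}
    (hT : ∀ r s, r + s ≤ l → deligneI W F r s ≤ T) : (W l).baseChange ℂ ≤ T := by
  obtain ⟨b, hb⟩ := hM.exists_F_eq_top
  have := hM.filtration_inf_le_of_deligneI_le (p := b) (l := l) fun r s _ hs => hT r s hs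
  rwa [hb, top_inf_eq] at this

/-- Modulo `W_(l-1)`, every element of `W_l` is the sum of an element of `F^(p+1)`, an element of
`I^(p,l-p)` and an element of `conj F^(l-p+1)`. -/
theorem IsMHS.baseChange_le_sup (hM : IsMHS W F) (hS : IsRSplit W F) (p l : ℤ) :
    (W l).baseChange ℂ ≤ (F (p + 1) ⊓ (W l).baseChange ℂ) ⊔ deligneI W F p (l - p) ⊔
      (conjSub (F (l - p + 1)) ⊓ (W l).baseChange ℂ) ⊔ (W (l - 1)).baseChange ℂ := by
  intro x hx
  obtain ⟨u, hu, v, hv, h⟩ := hM.exists_sub_add_mem (p + 1) l hx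
  have hv' : conjCx U v ∈ F (l - p) ⊓ (W l).baseChange ℂ := by
    refine ⟨?_, conjCx_mem_baseChange.2 hv.2⟩
    have := mem_conjSub.1 hv.1
    rwa [show l + 1 - (p + 1) = l - p by ring] at this
  obtain ⟨ab, hab, c, hc, habc⟩ := Submodule.mem_sup.1 (hM.filtration_inf_le _ _ hv')
  obtain ⟨a, ha, b, hb, rfl⟩ := Submodule.mem_sup.1 hab
  have e : x = u + conjCx U b + conjCx U a + (conjCx U c + (x - (u + v))) := by
    have : v = conjCx U a + conjCx U b + conjCx U c := by
      rw [← map_add, ← map_add, habc, conjCx_conjCx]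
    rw [this]; abel
  rw [e]
  refine add_mem (Submodule.mem_sup_left (add_mem (Submodule.mem_sup_left
    (add_mem (Submodule.mem_sup_left hu) (Submodule.mem_sup_right ?_)))
    (Submodule.mem_sup_right ⟨?_, ?_⟩))) (Submodule.mem_sup_right (add_mem ?_ h))
  · rw [sub_sub_cancel] at hb
    exact hS.conjCx_mem_deligneI.2 hb
  · exact mem_conjSub.2 (by simpa using ha.1)
  · exact conjCx_mem_baseChange.2 ha.2
  · exact conjCx_mem_baseChange.2 hc.2

/-- The component `I^(p,q)` is independent of `F^(p+1)` and `conj F^(q+1)` in the weight-graded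
piece. -/
theorem IsMHS.eq_zero_of_sub_add_mem (hM : IsMHS W F) (hS : IsRSplit W F) {p q : ℤ}
    {x u v : Cx U} (hx : x ∈ deligneI W F p q)
    (hu : u ∈ F (p + 1) ⊓ (W (p + q)).baseChange ℂ)
    (hv : v ∈ conjSub (F (q + 1)) ⊓ (W (p + q)).baseChange ℂ)
    (h : x - (u + v) ∈ (W (p + q - 1)).baseChange ℂ) : x = 0 := by
  obtain ⟨h1, h2, h3⟩ := hS.mem_deligneI.1 hx
  have hu' : u ∈ F p := hM.antitone (by omega) hu.1
  have hv' : conjCx U v ∈ F q := hM.antitone (by omega) (mem_conjSub.1 hv.1)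
  have hxu : x - u ∈ (W (p + q - 1)).baseChange ℂ := by
    refine hM.mem_of_sub_mem (k := p) (y := v) (sub_mem h1 hu') (sub_mem h3 hu.2) ?_ hv.2 ?_
    · rw [show p + q + 1 - p = q + 1 by ring]; exact hv.1
    · rwa [sub_sub]
  have hux : u ∈ (W (p + q - 1)).baseChange ℂ := by
    refine hM.mem_of_sub_mem (k := p + 1) (y := x - v) hu.1 hu.2 ?_ (sub_mem h3 hv.2) ?_
    · rw [show p + q + 1 - (p + 1) = q by ring]
      exact mem_conjSub.2 (by rw [map_sub]; exact sub_mem h2 hv')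
    · rw [show u - (x - v) = -(x - (u + v)) by abel]
      exact neg_mem h
  refine hM.eq_zero_of_mem_deligneI hS hx ?_
  simpa using add_mem hxu hux

end MixedHodgeStructures

/-! ### Primitive decomposition and polarization of an `ℝ`-split PMHS -/

section Primitive

variable {U : Type u} [AddCommGroup U] [Module ℝ U]

namespace Triple

variable {n : ℕ} {Q : LinearMap.BilinForm ℝ U} {X : Triple U}

@[simp] theorem reCx_baseChange_pow (N : Module.End ℝ U) (k : ℕ) (x : Cx U) :
    reCx U (((N.baseChange ℂ) ^ k) x) = (N ^ k) (reCx U x) := by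
  rw [← LinearMap.baseChange_pow, reCx_baseChange]

@[simp] theorem imCx_baseChange_pow (N : Module.End ℝ U) (k : ℕ) (x : Cx U) :
    imCx U (((N.baseChange ℂ) ^ k) x) = (N ^ k) (imCx U x) := by
  rw [← LinearMap.baseChange_pow, imCx_baseChange]

@[simp] theorem conjCx_baseChange_pow (N : Module.End ℝ U) (k : ℕ) (x : Cx U) :
    conjCx U (((N.baseChange ℂ) ^ k) x) = ((N.baseChange ℂ) ^ k) (conjCx U x) := by
  rw [← LinearMap.baseChange_pow, conjCx_baseChange]

theorem IsPMHS.apply_mem_W (hX : X.IsPMHS n Q) {l : ℤ} {u : U} (hu : u ∈ X.W l) :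
    X.N u ∈ X.W (l - 2) := by
  have := hX.weight.shift (l - n) u (by simpa using hu)
  simpa [show l - n - 2 + n = l - 2 by ring] using this

theorem IsPMHS.apply_mem_deligneI (hX : X.IsPMHS n Q) (hS : IsRSplit X.W X.F) {p q : ℤ}
    {x : Cx U} (hx : x ∈ deligneI X.W X.F p q) :
    X.N.baseChange ℂ x ∈ deligneI X.W X.F (p - 1) (q - 1) := by
  obtain ⟨h1, h2, h3⟩ := hS.mem_deligneI.1 hx
  refine hS.mem_deligneI.2 ⟨hX.horizontal _ _ h1, ?_, ?_⟩
  · rw [conjCx_baseChange]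
    exact hX.horizontal _ _ h2
  · rw [mem_baseChange_iff] at h3 ⊢
    rw [show p - 1 + (q - 1) = p + q - 2 by ring, reCx_baseChange, imCx_baseChange]
    exact ⟨hX.apply_mem_W h3.1, hX.apply_mem_W h3.2⟩

theorem IsPMHS.pow_apply_mem_deligneI (hX : X.IsPMHS n Q) (hS : IsRSplit X.W X.F) {p q : ℤ}
    {x : Cx U} (hx : x ∈ deligneI X.W X.F p q) (j : ℕ) :
    ((X.N.baseChange ℂ) ^ j) x ∈ deligneI X.W X.F (p - j) (q - j) := by
  induction j with
  | zero => simpa using hx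
  | succ j ih =>
    rw [pow_succ', Module.End.mul_apply]
    have := hX.apply_mem_deligneI hS ih
    rwa [sub_sub, sub_sub, ← Nat.cast_one (R := ℤ), ← Nat.cast_add] at this

theorem IsPMHS.eq_zero_of_pow_apply_eq_zero (hX : X.IsPMHS n Q) (hS : IsRSplit X.W X.F)
    {p q : ℤ} {l : ℕ} (hpq : p + q = n + l) {x : Cx U} (hx : x ∈ deligneI X.W X.F p q)
    (h0 : ((X.N.baseChange ℂ) ^ l) x = 0) : x = 0 := by
  obtain ⟨-, -, h3⟩ := hS.mem_deligneI.1 hx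
  refine hX.isMHS.eq_zero_of_mem_deligneI hS hx ?_
  rw [mem_baseChange_iff] at h3 ⊢
  rw [cx_eq_zero_iff, reCx_baseChange_pow, imCx_baseChange_pow] at h0
  rw [hpq, add_comm (n : ℤ)] at h3 ⊢
  rw [show (l : ℤ) + n - 1 = l - 1 + n by ring]
  exact ⟨hX.weight.injective l _ h3.1 (by rw [h0.1]; exact zero_mem _),
    hX.weight.injective l _ h3.2 (by rw [h0.2]; exact zero_mem _)⟩

theorem IsPMHS.exists_sub_pow_apply_mem (hX : X.IsPMHS n Q) {l : ℕ} {y : Cx U}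
    (hy : y ∈ (X.W (n - l)).baseChange ℂ) : ∃ x ∈ (X.W (n + l)).baseChange ℂ,
      y - ((X.N.baseChange ℂ) ^ l) x ∈ (X.W (n - l - 1)).baseChange ℂ := by
  rw [mem_baseChange_iff, show (n : ℤ) - l = -l + n by ring] at hy
  obtain ⟨a, ha, ha'⟩ := hX.weight.surjective l _ hy.1
  obtain ⟨b, hb, hb'⟩ := hX.weight.surjective l _ hy.2
  refine ⟨(1 : ℂ) ⊗ₜ a + Complex.I ⊗ₜ b, ?_, ?_⟩
  · rw [mem_baseChange_iff, add_comm (n : ℤ)]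
    simpa using ⟨ha, hb⟩
  · rw [mem_baseChange_iff, show (n : ℤ) - l - 1 = -l - 1 + n by ring, map_sub, map_sub,
      reCx_baseChange_pow, imCx_baseChange_pow]
    simpa using ⟨ha', hb'⟩

/-- Hard Lefschetz for the components of the splitting; surjectivity expresses the strictness of
`N^ℓ` with respect to the Hodge filtration and its conjugate. -/
theorem IsPMHS.exists_pow_apply_eq (hX : X.IsPMHS n Q) (hS : IsRSplit X.W X.F)
    {p q : ℤ} {l : ℕ} (hpq : p + q = n + l) {y : Cx U}
    (hy : y ∈ deligneI X.W X.F (p - l) (q - l)) :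
    ∃ x ∈ deligneI X.W X.F p q, ((X.N.baseChange ℂ) ^ l) x = y := by
  have hM := hX.isMHS
  have hw : p - l + (q - l) = n - l := by linarith
  have hyW := (hS.mem_deligneI.1 hy).2.2
  rw [hw] at hyW
  obtain ⟨x, hx, hxy⟩ := hX.exists_sub_pow_apply_mem hyW
  obtain ⟨t, ht, d, hd, h1⟩ := Submodule.mem_sup.1 (hM.baseChange_le_sup hS p _ hx)
  obtain ⟨t', ht', c, hc, h2⟩ := Submodule.mem_sup.1 ht
  obtain ⟨a, ha, b, hb, h3⟩ := Submodule.mem_sup.1 ht'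
  have hq : (n : ℤ) + l - p = q := by linarith
  rw [hq] at hb hc
  set M := (X.N.baseChange ℂ) ^ l with hM'
  have hMW : ∀ {k : ℤ} {z : Cx U}, z ∈ (X.W k).baseChange ℂ →
      M z ∈ (X.W (k - 2 * l)).baseChange ℂ := by
    intro k z hz
    rw [mem_baseChange_iff] at hz ⊢
    have : ∀ (j : ℕ) (u : U), u ∈ X.W k → (X.N ^ j) u ∈ X.W (k - 2 * j) := by
      intro j u hu
      induction j with
      | zero => simpa using hu
      | succ j ih =>
        rw [pow_succ', Module.End.mul_apply]
        have := hX.apply_mem_W ih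
        rwa [show k - 2 * (j : ℤ) - 2 = k - 2 * ((j + 1 : ℕ) : ℤ) by push_cast; ring] at this
    rw [hM', reCx_baseChange_pow, imCx_baseChange_pow]
    exact ⟨this l _ hz.1, this l _ hz.2⟩
  have hMF : ∀ {k : ℤ} {z : Cx U}, z ∈ X.F k → M z ∈ X.F (k - l) := by
    intro k z hz
    have : ∀ (j : ℕ), ((X.N.baseChange ℂ) ^ j) z ∈ X.F (k - j) := by
      intro j
      induction j with
      | zero => simpa using hz
      | succ j ih =>
        rw [pow_succ', Module.End.mul_apply]
        have := hX.horizontal _ _ ih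
        rwa [show k - (j : ℤ) - 1 = k - ((j + 1 : ℕ) : ℤ) by push_cast; ring] at this
    exact this l
  refine ⟨b, hb, ?_⟩
  have hk : (n : ℤ) + l - 2 * l = n - l := by ring
  refine (sub_eq_zero.1 (hM.eq_zero_of_sub_add_mem hS (u := M a) (v := M c)
    (sub_mem hy (hX.pow_apply_mem_deligneI hS hb l)) ⟨?_, ?_⟩ ⟨?_, ?_⟩ ?_)).symm
  · have := hMF ha.1
    rwa [show p + 1 - (l : ℤ) = p - l + 1 by ring] at this
  · rw [hw, ← hk]; exact hMW ha.2
  · refine mem_conjSub.2 ?_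
    rw [hM', conjCx_baseChange_pow]
    have := hMF (mem_conjSub.1 hc.1)
    rwa [show q + 1 - (l : ℤ) = q - l + 1 by ring] at this
  · rw [hw, ← hk]; exact hMW hc.2
  · have h4 : y - M b - (M a + M c) = (y - M x) + M d := by
      rw [← h1, ← h2, ← h3]; simp only [map_add]; abel
    have h5 := hMW hd
    rw [show (n : ℤ) + l - 1 - 2 * l = n - l - 1 by ring] at h5
    change y - M b - _ ∈ _
    rw [h4, hw]
    exact add_mem hxy h5

theorem mem_prim {l : ℕ} {p q : ℤ} {x : Cx U} :
    x ∈ X.prim l p q ↔ x ∈ deligneI X.W X.F p q ∧ ((X.N.baseChange ℂ) ^ (l + 1)) x = 0 := by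
  rw [prim, Submodule.mem_inf, LinearMap.mem_ker, LinearMap.baseChange_pow]

theorem conjCx_mem_prim (hS : IsRSplit X.W X.F) {l : ℕ} {p q : ℤ} {x : Cx U} :
    conjCx U x ∈ X.prim l q p ↔ x ∈ X.prim l p q := by
  rw [mem_prim, mem_prim, hS.conjCx_mem_deligneI, ← conjCx_baseChange_pow,
    map_eq_zero_iff _ conjCx_injective]

/-- One step of the primitive decomposition, `I^(p,q) = P^(p,q) + N I^(p+1,q+1)`: the Lefschetz
isomorphism `N^(ℓ+2)` on `I^(p+1,q+1)` provides `y` with `N^(ℓ+1) (x - N y) = 0`. -/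
theorem IsPMHS.exists_prim_add (hX : X.IsPMHS n Q) (hS : IsRSplit X.W X.F) {p q : ℤ} {l : ℕ}
    (hpq : p + q = n + l) {x : Cx U} (hx : x ∈ deligneI X.W X.F p q) :
    ∃ x' ∈ X.prim l p q, ∃ y ∈ deligneI X.W X.F (p + 1) (q + 1),
      x = x' + X.N.baseChange ℂ y := by
  have h1 := hX.pow_apply_mem_deligneI hS hx (l + 1)
  rw [show p - ((l + 1 : ℕ) : ℤ) = p + 1 - (l + 2 : ℕ) by push_cast; ring,
    show q - ((l + 1 : ℕ) : ℤ) = q + 1 - (l + 2 : ℕ) by push_cast; ring] at h1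
  obtain ⟨y, hy, hxy⟩ := hX.exists_pow_apply_eq hS (by push_cast; linarith) h1
  refine ⟨x - X.N.baseChange ℂ y, mem_prim.2 ⟨sub_mem hx ?_, ?_⟩, y, hy, by abel⟩
  · simpa using hX.apply_mem_deligneI hS hy
  · rw [map_sub, ← Module.End.mul_apply, ← pow_succ, hxy, sub_self]

theorem IsPMHS.eq_zero_of_mem_deligneI_of_lt (hX : X.IsPMHS n Q) (hS : IsRSplit X.W X.F)
    {p q : ℤ} {l : ℕ} (hpq : p + q = n + l) (hl : n < l) {x : Cx U}
    (hx : x ∈ deligneI X.W X.F p q) : x = 0 := by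
  refine hX.eq_zero_of_pow_apply_eq_zero hS hpq hx ?_
  rw [← LinearMap.baseChange_pow, pow_eq_zero_of_le (by omega : n + 1 ≤ l) hX.nilpotent]
  simp

/-- The primitive decomposition: `I^(r,s)` is spanned by the `N^j P^(r+j,s+j)`. -/
theorem IsPMHS.deligneI_le (hX : X.IsPMHS n Q) (hS : IsRSplit X.W X.F)
    {T : ℤ → ℤ → Submodule ℂ (Cx U)}
    (hT : ∀ (l j : ℕ) (p q : ℤ), j ≤ l → p + q = n + l → ∀ x ∈ X.prim l p q,
      ((X.N.baseChange ℂ) ^ j) x ∈ T (p - j) (q - j)) (r s : ℤ) :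
    deligneI X.W X.F r s ≤ T r s := by
  -- Downward induction on `l`; the components of weight `n + l`, `l > n`, vanish.
  have key : ∀ m l : ℕ, n < l + m → ∀ p q : ℤ, p + q = n + l → ∀ x ∈ deligneI X.W X.F p q,
      ∀ j : ℕ, j ≤ l → ((X.N.baseChange ℂ) ^ j) x ∈ T (p - j) (q - j) := by
    intro m
    induction m with
    | zero =>
      intro l hl p q hpq x hx j _
      rw [hX.eq_zero_of_mem_deligneI_of_lt hS hpq (by simpa using hl) hx, map_zero]
      exact zero_mem _
    | succ m ih =>
      intro l hl p q hpq x hx j hj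
      obtain ⟨x', hx', y, hy, rfl⟩ := hX.exists_prim_add hS hpq hx
      rw [map_add, ← Module.End.mul_apply, ← pow_succ]
      refine add_mem (hT l j p q hj hpq x' hx') ?_
      have := ih (l + 2) (by omega) (p + 1) (q + 1) (by push_cast; linarith) y hy (j + 1)
        (by omega)
      rwa [show p + 1 - ((j + 1 : ℕ) : ℤ) = p - j by push_cast; ring,
        show q + 1 - ((j + 1 : ℕ) : ℤ) = q - j by push_cast; ring] at this
  intro x hx
  rcases le_total (n : ℤ) (r + s) with h | h
  · obtain ⟨l, hl⟩ := Int.eq_ofNat_of_zero_le (sub_nonneg.2 h)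
    simpa using key (n + 1) l (by omega) r s (by linarith) x hx 0 (by omega)
  · obtain ⟨l, hl⟩ := Int.eq_ofNat_of_zero_le (sub_nonneg.2 h)
    have hx' : x ∈ deligneI X.W X.F (r + l - l) (s + l - l) := by simpa using hx
    have hw : r + l + (s + l) = n + l := by linarith
    obtain ⟨y, hy, rfl⟩ := hX.exists_pow_apply_eq hS hw hx'
    simpa using key (n + 1) l (by omega) _ _ hw y hy l le_rfl

theorem IsPMHS.bilin_pow_left (hX : X.IsPMHS n Q) (j : ℕ) (x y : Cx U) :
    Q.baseChange ℂ (((X.N.baseChange ℂ) ^ j) x) y =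
      (-1) ^ j * Q.baseChange ℂ x (((X.N.baseChange ℂ) ^ j) y) := by
  induction j generalizing x y with
  | zero => simp
  | succ j ih =>
    rw [pow_succ', Module.End.mul_apply, bilin_baseChange_skew hX.mem_lieAlgebra, ih,
      ← Module.End.mul_apply, ← pow_succ, pow_succ', pow_succ]
    ring

theorem IsPMHS.bilin_eq_zero (hX : X.IsPMHS n Q) {p q : ℤ} (hpq : n < p + q) {x y : Cx U}
    (hx : x ∈ X.F p) (hy : y ∈ X.F q) : Q.baseChange ℂ x y = 0 :=
  hX.isotropic p (n + 1 - p) (by ring) x hx y (hX.isMHS.antitone (by omega) hy)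

/-- Strings `N^j P^(p,q)` and `N^k P^(p',q')` are `Q`-orthogonal unless they are dual to each
other: types are bounded by isotropy of `F` and `conj F`, and `N^(j+k)` has to be nonzero on both
primitive spaces. -/
theorem IsPMHS.dual_of_bilin_ne_zero (hX : X.IsPMHS n Q) (hS : IsRSplit X.W X.F)
    {l l' j k : ℕ} {p q p' q' : ℤ} (hpq : p + q = n + l) (hpq' : p' + q' = n + l') {x y : Cx U}
    (hx : x ∈ X.prim l p q) (hy : y ∈ X.prim l' p' q')
    (h : Q.baseChange ℂ (((X.N.baseChange ℂ) ^ j) x) (((X.N.baseChange ℂ) ^ k) y) ≠ 0) :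
    l' = l ∧ p' = q ∧ j + k = l := by
  rw [mem_prim] at hx hy
  have h1 : j + k ≤ l' := by
    by_contra! hlt
    apply h
    rw [hX.bilin_pow_left, ← Module.End.mul_apply, ← pow_add,
      show j + k = (j + k - (l' + 1)) + (l' + 1) by omega, pow_add, Module.End.mul_apply, hy.2]
    simp
  have h2 : j + k ≤ l := by
    by_contra! hlt
    have h0 : ((X.N.baseChange ℂ) ^ (k + j)) x = 0 := by
      rw [show k + j = (j + k - (l + 1)) + (l + 1) by omega, pow_add, Module.End.mul_apply, hx.2,
        map_zero]
    have h3 := hX.bilin_pow_left k (((X.N.baseChange ℂ) ^ j) x) y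
    rw [← Module.End.mul_apply, ← pow_add, h0] at h3
    simp only [map_zero, LinearMap.zero_apply, zero_eq_mul, pow_eq_zero_iff', neg_eq_zero,
      one_ne_zero, false_and, false_or] at h3
    exact h h3
  obtain ⟨a1, a2, -⟩ := hS.mem_deligneI.1 (hX.pow_apply_mem_deligneI hS hx.1 j)
  obtain ⟨b1, b2, -⟩ := hS.mem_deligneI.1 (hX.pow_apply_mem_deligneI hS hy.1 k)
  have h3 : p - j + (p' - k) ≤ n := by
    by_contra! hlt
    exact h (hX.bilin_eq_zero hlt a1 b1)
  have h4 : q - j + (q' - k) ≤ n := by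
    by_contra! hlt
    have := hX.bilin_eq_zero hlt a2 b2
    rw [conjCx_bilin] at this
    exact h (by simpa using this)
  omega

/-- The Hodge form `i^(p-q) Q(x, N^ℓ conj y)` on `U_ℂ`, which is positive definite on the primitive
space `P(N)^(p,q)`, `p + q = n + ℓ`. -/
noncomputable def hodgeForm (Q : LinearMap.BilinForm ℝ U) (X : Triple U) (l : ℕ) (p q : ℤ)
    (x y : Cx U) : ℂ :=
  Complex.I ^ (p - q) * Q.baseChange ℂ x (((X.N.baseChange ℂ) ^ l) (conjCx U y))

theorem IsPMHS.conj_hodgeForm (hX : X.IsPMHS n Q) (hQ : ∀ u v, Q u v = (-1) ^ n * Q v u) {l : ℕ}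
    {p q : ℤ} (hpq : p + q = n + l) (x y : Cx U) :
    starRingEnd ℂ (X.hodgeForm Q l p q y x) = X.hodgeForm Q l p q x y := by
  have h1 : (-1 : ℂ) ^ (p - q) * ((-1) ^ n * (-1) ^ l) = 1 := by
    rw [← zpow_natCast, ← zpow_natCast, ← zpow_add₀ (by norm_num), ← zpow_add₀ (by norm_num),
      ← hpq, show p - q + (p + q) = p + p by ring, zpow_add₀ (by norm_num), ← mul_zpow]
    simp
  rw [hodgeForm, hodgeForm, map_mul, ← conjCx_bilin, conjCx_baseChange_pow, conjCx_conjCx,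
    bilin_baseChange_symm hQ, hX.bilin_pow_left, map_zpow₀, Complex.conj_I, neg_eq_neg_one_mul,
    mul_zpow]
  linear_combination (Complex.I ^ (p - q) * Q.baseChange ℂ x
    (((X.N.baseChange ℂ) ^ l) (conjCx U y))) * h1

theorem IsPMHS.hodgeForm_pos (hX : X.IsPMHS n Q) (hS : IsRSplit X.W X.F) {l : ℕ} {p q : ℤ}
    (hpq : p + q = n + l) {x : Cx U} (hx : x ∈ X.prim l p q) (hx0 : x ≠ 0) :
    (X.hodgeForm Q l p q x x).im = 0 ∧ 0 < (X.hodgeForm Q l p q x x).re := by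
  obtain ⟨B, hB, hpol⟩ := hX.polarized l
  rw [mem_prim] at hx
  obtain ⟨h1, h2, h3⟩ := hS.mem_deligneI.1 hx.1
  rw [hpq] at h3
  -- `K` is the space of representatives of primitive classes; `x` lifts to `z ∈ K_ℂ`.
  let K : Submodule ℝ (X.W (n + l)) :=
    (X.W ((n : ℤ) - l - 3)).comap ((X.N ^ (l + 1)) ∘ₗ (X.W (n + l)).subtype)
  let π : K →ₗ[ℝ] X.primGr n l := (grMk X.W (n + l)).submoduleMap K
  let f : K →ₗ[ℝ] U := (X.W (n + l)).subtype ∘ₗ K.subtype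
  have hform : ∀ z z' : Cx K, B.baseChange ℂ (π.baseChange ℂ z) (π.baseChange ℂ z') =
      Q.baseChange ℂ (f.baseChange ℂ z) (((X.N.baseChange ℂ) ^ l) (f.baseChange ℂ z')) := by
    intro z z'
    rw [← bilin_baseChange_congr (B := B.compl₁₂ π π) (fun _ _ => rfl),
      bilin_baseChange_congr (B := B.compl₁₂ π π) (B' := Q) (f := f) (g := (X.N ^ l) ∘ₗ f),
      ← LinearMap.baseChange_pow]
    · exact congrArg _ (LinearMap.congr_fun (LinearMap.baseChange_comp f (X.N ^ l)) z')
    · intro u v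
      exact hB (π u) (π v) u v rfl rfl
  obtain ⟨z, hz⟩ : ∃ z : Cx K, f.baseChange ℂ z = x := by
    rw [mem_baseChange_iff] at h3
    have h0 := hx.2
    rw [cx_eq_zero_iff, reCx_baseChange_pow, imCx_baseChange_pow] at h0
    have hK : ∀ (u : U) (hu : u ∈ X.W (n + l)), (X.N ^ (l + 1)) u = 0 → ⟨u, hu⟩ ∈ K := by
      intro u hu h
      refine Submodule.mem_comap.2 ?_
      change (X.N ^ (l + 1)) u ∈ _
      rw [h]; exact zero_mem _
    refine ⟨(1 : ℂ) ⊗ₜ ⟨⟨reCx U x, h3.1⟩, hK _ _ h0.1⟩ +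
      Complex.I ⊗ₜ ⟨⟨imCx U x, h3.2⟩, hK _ _ h0.2⟩, ?_⟩
    simpa [f] using re_add_im_cx x
  have hsub : ∀ z : Cx K, (X.primGr n l).subtype.baseChange ℂ (π.baseChange ℂ z) =
      (grMk X.W (n + l)).baseChange ℂ (K.subtype.baseChange ℂ z) := by
    intro z
    rw [← LinearMap.comp_apply, ← LinearMap.baseChange_comp, ← LinearMap.comp_apply,
      ← LinearMap.baseChange_comp]
    rfl
  have hf : ∀ z : Cx K, (X.W (n + l)).subtype.baseChange ℂ (K.subtype.baseChange ℂ z) =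
      f.baseChange ℂ z := by
    intro z
    rw [← LinearMap.comp_apply, ← LinearMap.baseChange_comp]
  have hmem : ∀ (z : Cx K) (r : ℤ), f.baseChange ℂ z ∈ X.F r →
      π.baseChange ℂ z ∈ X.primFiltration n l r := by
    intro z r h
    refine Submodule.mem_comap.2 ?_
    rw [hsub]
    exact mem_grFiltration.2 ⟨_, by rwa [hf], rfl⟩
  have hne : π.baseChange ℂ z ≠ 0 := by
    intro h0
    have h4 := hsub z
    rw [h0, map_zero] at h4
    have h5 := grMk_baseChange_eq_zero_iff.1 h4.symm
    rw [hf, hz, ← hpq] at h5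
    exact hx0 (hX.isMHS.eq_zero_of_mem_deligneI hS hx.1 h5)
  have := hpol.riemann_positive p q hpq (π.baseChange ℂ z)
    ⟨hmem z p (by rwa [hz]), mem_conjSub.2 (by
      rw [conjCx_baseChange]
      exact hmem _ q (by rwa [← conjCx_baseChange, hz]))⟩ hne
  rwa [conjCx_baseChange, hform, ← conjCx_baseChange, hz] at this

end Triple

end Primitive

/-! ### Adapted frames -/

theorem exists_orthonormal_basis_of_core {𝕜 P : Type*} [RCLike 𝕜] [AddCommGroup P] [Module 𝕜 P]
    [FiniteDimensional 𝕜 P] (c : InnerProductSpace.Core 𝕜 P) :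
    ∃ b : Module.Basis (Fin (Module.finrank 𝕜 P)) 𝕜 P,
      ∀ i j, c.inner (b i) (b j) = if i = j then 1 else 0 := by
  let _ := c.toNormedAddCommGroup
  let _ := InnerProductSpace.ofCore c.toCore
  let b := stdOrthonormalBasis 𝕜 P
  refine ⟨b.toBasis, fun i j => ?_⟩
  have := orthonormal_iff_ite.1 b.orthonormal i j
  simpa using this

section Frames

variable {U : Type u} [AddCommGroup U] [Module ℝ U]

/-- The real points `{u | 1 ⊗ u ∈ P}` of a complex subspace `P` of `U_ℂ`. -/
noncomputable def realPoints (P : Submodule ℂ (Cx U)) : Submodule ℝ U :=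
  (P.restrictScalars ℝ).comap (TensorProduct.mk ℝ ℂ U 1)

theorem mem_realPoints {P : Submodule ℂ (Cx U)} {u : U} :
    u ∈ realPoints P ↔ (1 : ℂ) ⊗ₜ[ℝ] u ∈ P := Iff.rfl

theorem I_smul_one_tmul (u : U) : Complex.I • ((1 : ℂ) ⊗ₜ[ℝ] u) = Complex.I ⊗ₜ[ℝ] u := by
  simp [TensorProduct.smul_tmul']

theorem baseChange_realPoints {P : Submodule ℂ (Cx U)} (hP : ∀ x ∈ P, conjCx U x ∈ P) :
    (realPoints P).baseChange ℂ = P := by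
  ext x
  rw [mem_baseChange_iff, mem_realPoints, mem_realPoints]
  constructor
  · rintro ⟨h1, h2⟩
    rw [← re_add_im_cx x, ← I_smul_one_tmul]
    exact add_mem h1 (P.smul_mem _ h2)
  · intro h
    have hc := hP x h
    have e1 : (1 : ℂ) ⊗ₜ[ℝ] reCx U x = (2⁻¹ : ℂ) • (x + conjCx U x) := by
      rw [conjCx_eq]
      conv_rhs => rw [← re_add_im_cx x]
      simp only [map_add, reCx_tmul, imCx_tmul]
      simp only [Complex.one_re, Complex.I_re, Complex.one_im, Complex.I_im, one_smul, zero_smul,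
        add_zero, zero_add]
      module
    have e2 : (1 : ℂ) ⊗ₜ[ℝ] imCx U x = (-(2⁻¹ : ℂ) * Complex.I) • (x - conjCx U x) := by
      rw [conjCx_eq]
      conv_rhs => rw [← re_add_im_cx x]
      simp only [map_add, reCx_tmul, imCx_tmul]
      simp only [Complex.one_re, Complex.I_re, Complex.one_im, Complex.I_im, one_smul, zero_smul,
        add_zero, zero_add, ← I_smul_one_tmul]
      match_scalars
      · linear_combination (1 : ℂ) * Complex.I_mul_I
      · ring
    rw [e1, e2]
    exact ⟨P.smul_mem _ (add_mem h hc), P.smul_mem _ (sub_mem h hc)⟩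

theorem finrank_realPoints {P : Submodule ℂ (Cx U)} (hP : ∀ x ∈ P, conjCx U x ∈ P) :
    Module.finrank ℝ (realPoints P) = Module.finrank ℂ P := by
  have hinj : Function.Injective ((realPoints P).subtype.baseChange ℂ) := by
    rw [injective_iff_map_eq_zero]
    intro x hx
    rw [cx_eq_zero_iff] at hx ⊢
    simpa using hx
  have h1 := (LinearEquiv.ofInjective _ hinj).finrank_eq
  rw [Module.finrank_baseChange] at h1
  conv_rhs => rw [← baseChange_realPoints hP]
  exact h1

theorem finrank_conjSub (P : Submodule ℂ (Cx U)) :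
    Module.finrank ℂ (conjSub P) = Module.finrank ℂ P := by
  let j : P ≃+ conjSub P :=
    { toFun := fun x => ⟨conjCx U x, Submodule.mem_map_of_mem x.2⟩
      invFun := fun x => ⟨conjCx U x, mem_conjSub.1 x.2⟩
      left_inv := fun x => by ext; simp
      right_inv := fun x => by ext; simp
      map_add' := fun x y => by ext; simp }
  have := rank_eq_of_equiv_equiv (starRingEnd ℂ) j (starRingAut (R := ℂ)).bijective
    (fun r m => by ext; simp [j])
  rw [Module.finrank, Module.finrank, this]

namespace Triple

variable {n : ℕ} {Q : LinearMap.BilinForm ℝ U} {X : Triple U}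

theorem hodgeForm_add_right (l : ℕ) (p q : ℤ) (x y z : Cx U) :
    X.hodgeForm Q l p q x (y + z) = X.hodgeForm Q l p q x y + X.hodgeForm Q l p q x z := by
  simp [hodgeForm, mul_add]

theorem hodgeForm_smul_right (l : ℕ) (p q : ℤ) (c : ℂ) (x y : Cx U) :
    X.hodgeForm Q l p q x (c • y) = starRingEnd ℂ c * X.hodgeForm Q l p q x y := by
  simp only [hodgeForm, map_smulₛₗ, smul_eq_mul, RingHom.id_apply]
  ring

theorem hodgeForm_one_tmul (l : ℕ) (p : ℤ) (u v : U) :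
    X.hodgeForm Q l p p ((1 : ℂ) ⊗ₜ u) ((1 : ℂ) ⊗ₜ v) = Q u ((X.N ^ l) v) := by
  rw [hodgeForm, ← LinearMap.baseChange_pow]
  simp

/-- An orthonormal basis of `P(N)^(p,q)` for the Hodge form. -/
theorem IsPMHS.exists_orthonormal [Module.Finite ℝ U] (hX : X.IsPMHS n Q)
    (hS : IsRSplit X.W X.F) (hQ : ∀ u v, Q u v = (-1) ^ n * Q v u) {l : ℕ} {p q : ℤ}
    (hpq : p + q = n + l) :
    ∃ b : Fin (Module.finrank ℂ (X.prim l p q)) → Cx U, (∀ i, b i ∈ X.prim l p q) ∧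
      X.prim l p q ≤ Submodule.span ℂ (Set.range b) ∧
      ∀ i j, X.hodgeForm Q l p q (b i) (b j) = if i = j then 1 else 0 := by
  have hpos : ∀ x : X.prim l p q, x ≠ 0 → 0 < (X.hodgeForm Q l p q (x : Cx U) x).re :=
    fun x hx => (hX.hodgeForm_pos hS hpq x.2 (by simpa using hx)).2
  -- Mathlib's inner products are conjugate linear in the first variable, `hodgeForm` in the second.
  let c : InnerProductSpace.Core ℂ (X.prim l p q) :=
    { inner := fun x y => X.hodgeForm Q l p q (y : Cx U) x
      conj_inner_symm := fun x y => hX.conj_hodgeForm hQ hpq _ _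
      re_inner_nonneg := fun x => by
        rcases eq_or_ne x 0 with rfl | hx
        · simp [hodgeForm]
        · exact (hpos x hx).le
      add_left := fun x y z => hodgeForm_add_right _ _ _ _ _ _
      smul_left := fun x y r => hodgeForm_smul_right _ _ _ _ _ _
      definite := fun x hx => by
        by_contra hne
        have h1 := hpos x hne
        change X.hodgeForm Q l p q (x : Cx U) x = 0 at hx
        rw [hx] at h1
        simp at h1 }
  obtain ⟨b, hb⟩ := exists_orthonormal_basis_of_core c
  refine ⟨fun i => b i, fun i => (b i).2, fun x hx => ?_, fun i j => ?_⟩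
  · have h1 : (⟨x, hx⟩ : X.prim l p q) ∈ Submodule.span ℂ (Set.range b) := by
      rw [b.span_eq]; trivial
    have h2 := Submodule.mem_map_of_mem (f := (X.prim l p q).subtype) h1
    rw [Submodule.map_span, ← Set.range_comp] at h2
    exact h2
  · have := hb j i
    simp only [eq_comm (a := j)] at this
    exact this

/-- For `p = q` the orthonormal basis can be chosen real. -/
theorem IsPMHS.exists_orthonormal_real [Module.Finite ℝ U] (hX : X.IsPMHS n Q)
    (hS : IsRSplit X.W X.F) (hQ : ∀ u v, Q u v = (-1) ^ n * Q v u) {l : ℕ} {p : ℤ}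
    (hp : p + p = n + l) :
    ∃ b : Fin (Module.finrank ℂ (X.prim l p p)) → Cx U, (∀ i, b i ∈ X.prim l p p) ∧
      X.prim l p p ≤ Submodule.span ℂ (Set.range b) ∧
      (∀ i j, X.hodgeForm Q l p p (b i) (b j) = if i = j then 1 else 0) ∧
      ∀ i, conjCx U (b i) = b i := by
  have hconj : ∀ x ∈ X.prim l p p, conjCx U x ∈ X.prim l p p :=
    fun x hx => (conjCx_mem_prim hS).2 hx
  have hpos : ∀ x : realPoints (X.prim l p p), x ≠ 0 → 0 < Q (x : U) ((X.N ^ l) x) := by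
    intro x hx
    have h0 : (1 : ℂ) ⊗ₜ[ℝ] (x : U) ≠ 0 := by
      intro h
      rw [cx_eq_zero_iff] at h
      exact hx (by simpa using h.1)
    have := (hX.hodgeForm_pos hS hp (mem_realPoints.1 x.2) h0).2
    rwa [hodgeForm_one_tmul, Complex.ofReal_re] at this
  let c : InnerProductSpace.Core ℝ (realPoints (X.prim l p p)) :=
    { inner := fun x y => Q (y : U) ((X.N ^ l) (x : U))
      conj_inner_symm := fun x y => by
        have := hX.conj_hodgeForm hQ hp ((1 : ℂ) ⊗ₜ (y : U)) ((1 : ℂ) ⊗ₜ (x : U))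
        rw [hodgeForm_one_tmul, hodgeForm_one_tmul, Complex.conj_ofReal] at this
        simpa using Complex.ofReal_injective this
      re_inner_nonneg := fun x => by
        rcases eq_or_ne x 0 with rfl | hx
        · simp
        · exact (hpos x hx).le
      add_left := fun x y z => by simp
      smul_left := fun x y r => by simp
      definite := fun x hx => by
        by_contra hne
        exact (hpos x hne).ne' hx }
  have hc := exists_orthonormal_basis_of_core c
  rw [finrank_realPoints hconj] at hc
  obtain ⟨b, hb⟩ := hc
  refine ⟨fun i => (1 : ℂ) ⊗ₜ (b i : U), fun i => (b i).2, fun x hx => ?_, fun i j => ?_,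
    fun i => by simp⟩
  · have hle : realPoints (X.prim l p p) ≤
        realPoints (Submodule.span ℂ (Set.range fun i => (1 : ℂ) ⊗ₜ[ℝ] (b i : U))) := by
      intro u hu
      have h1 : (⟨u, hu⟩ : realPoints (X.prim l p p)) ∈ Submodule.span ℝ (Set.range b) := by
        rw [b.span_eq]; trivial
      have h2 := Submodule.mem_map_of_mem (f := (realPoints (X.prim l p p)).subtype) h1
      rw [Submodule.map_span, ← Set.range_comp] at h2
      refine Submodule.span_le.2 ?_ h2
      rintro _ ⟨i, rfl⟩
      exact Submodule.subset_span ⟨i, rfl⟩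
    rw [← baseChange_realPoints hconj, mem_baseChange_iff] at hx
    rw [← re_add_im_cx x, ← I_smul_one_tmul]
    exact add_mem (hle hx.1) (Submodule.smul_mem _ _ (hle hx.2))
  · have := hb j i
    simp only [eq_comm (a := j)] at this
    change Q (b i : U) ((X.N ^ l) (b j : U)) = _ at this
    rw [hodgeForm_one_tmul, this]
    split_ifs <;> simp

/-- A family `e l p a`, `a < d l p`, of bases of the primitive spaces `P(N)^(p,n+l-p)` which are
orthonormal for the Hodge form and are permuted by complex conjugation. The values for
`a ≥ d l p` are irrelevant; a total function avoids dependent index types. -/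
structure IsAdaptedFrame (n : ℕ) (Q : LinearMap.BilinForm ℝ U) (X : Triple U) (d : ℕ → ℤ → ℕ)
    (e : ℕ → ℤ → ℕ → Cx U) : Prop where
  mem : ∀ l p a, e l p a ∈ X.prim l p (n + l - p)
  prim_le : ∀ l p, X.prim l p (n + l - p) ≤ Submodule.span ℂ (e l p '' Set.Iio (d l p))
  conj : ∀ l p a, conjCx U (e l p a) = e l (n + l - p) a
  hodgeForm_eq : ∀ l p a b, a < d l p → b < d l p →
    X.hodgeForm Q l p (n + l - p) (e l p a) (e l p b) = if a = b then 1 else 0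

theorem finrank_prim_swap (hS : IsRSplit X.W X.F) (l : ℕ) (p q : ℤ) :
    Module.finrank ℂ (X.prim l q p) = Module.finrank ℂ (X.prim l p q) := by
  have : X.prim l q p = conjSub (X.prim l p q) := by
    ext x
    rw [mem_conjSub, conjCx_mem_prim hS]
  rw [this, finrank_conjSub]

theorem IsPMHS.hodgeForm_conjCx (hX : X.IsPMHS n Q) (hQ : ∀ u v, Q u v = (-1) ^ n * Q v u)
    {l : ℕ} {p q : ℤ} (hpq : p + q = n + l) (x y : Cx U) :
    X.hodgeForm Q l q p (conjCx U x) (conjCx U y) = X.hodgeForm Q l p q y x := by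
  rw [← hX.conj_hodgeForm hQ hpq, hodgeForm, hodgeForm, ← conjCx_baseChange_pow, conjCx_bilin,
    map_mul, map_zpow₀, Complex.conj_I, ← Complex.inv_I, inv_zpow', neg_sub]

theorem IsPMHS.exists_isAdaptedFrame [Module.Finite ℝ U] (hX : X.IsPMHS n Q)
    (hS : IsRSplit X.W X.F) (hQ : ∀ u v, Q u v = (-1) ^ n * Q v u) :
    ∃ e, X.IsAdaptedFrame n Q (fun l p => Module.finrank ℂ (X.prim l p (n + l - p))) e := by
  have key : ∀ (l : ℕ) (p q : ℤ), p + q = n + l → ∃ f : ℕ → Cx U, (∀ a, f a ∈ X.prim l p q) ∧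
      X.prim l p q ≤ Submodule.span ℂ (f '' Set.Iio (Module.finrank ℂ (X.prim l p q))) ∧
      (∀ a b, a < Module.finrank ℂ (X.prim l p q) → b < Module.finrank ℂ (X.prim l p q) →
        X.hodgeForm Q l p q (f a) (f b) = if a = b then 1 else 0) ∧
      (p = q → ∀ a, conjCx U (f a) = f a) := by
    intro l p q hpq
    obtain ⟨b, hb, hspan, ho, hr⟩ : ∃ b : Fin (Module.finrank ℂ (X.prim l p q)) → Cx U,
        (∀ i, b i ∈ X.prim l p q) ∧ X.prim l p q ≤ Submodule.span ℂ (Set.range b) ∧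
        (∀ i j, X.hodgeForm Q l p q (b i) (b j) = if i = j then 1 else 0) ∧
        (p = q → ∀ i, conjCx U (b i) = b i) := by
      rcases eq_or_ne p q with rfl | hne
      · obtain ⟨b, hb, hspan, ho, hr⟩ := hX.exists_orthonormal_real hS hQ hpq
        exact ⟨b, hb, hspan, ho, fun _ => hr⟩
      · obtain ⟨b, hb, hspan, ho⟩ := hX.exists_orthonormal hS hQ hpq
        exact ⟨b, hb, hspan, ho, fun h => absurd h hne⟩
    refine ⟨fun a => if h : a < _ then b ⟨a, h⟩ else 0, fun a => ?_, hspan.trans ?_,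
      fun a a' ha ha' => ?_, fun h a => ?_⟩
    · dsimp only
      split_ifs
      exacts [hb _, zero_mem _]
    · refine Submodule.span_mono ?_
      rintro _ ⟨i, rfl⟩
      exact ⟨i, i.2, by simp⟩
    · simp only [ha, ha', dif_pos, ho, Fin.mk.injEq]
    · dsimp only
      split_ifs
      exacts [hr h _, map_zero _]
  choose f hf hspan ho hr using fun (l : ℕ) (p : ℤ) => key l p (n + l - p) (by ring)
  have hswap : ∀ (l : ℕ) (p : ℤ), (n : ℤ) + l - (n + l - p) = p := fun l p => by ring
  have hd : ∀ (l : ℕ) (p : ℤ), Module.finrank ℂ (X.prim l (n + l - p) (n + l - (n + l - p))) =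
      Module.finrank ℂ (X.prim l p (n + l - p)) := fun l p => by
    rw [hswap, finrank_prim_swap hS]
  -- For `p < q` the frame is the conjugate of the one for `(q, p)`.
  refine ⟨fun l p a => if n + l - p ≤ p then f l p a else conjCx U (f l (n + l - p) a),
    fun l p a => ?_, fun l p => ?_, fun l p a => ?_, fun l p a b ha hb => ?_⟩
  · split_ifs
    · exact hf l p a
    · have := hf l (n + l - p) a
      rw [hswap] at this
      exact (conjCx_mem_prim hS).2 this
  · by_cases h : n + l - p ≤ p
    · simpa only [h, if_true] using hspan l p
    · simp only [h, if_false]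
      intro x hx
      have h1 : conjCx U x ∈ X.prim l (n + l - p) (n + l - (n + l - p)) := by
        rw [hswap]; exact (conjCx_mem_prim hS).2 hx
      have h2 := Submodule.mem_map_of_mem (f := conjCx U) (hspan _ _ h1)
      rw [Submodule.map_span, conjCx_conjCx, ← Set.image_comp, hd] at h2
      exact h2
  · rw [hswap]
    split_ifs with h1 h2 h2
    · have h3 : (n : ℤ) + l - p = p := le_antisymm h1 h2
      rw [hr l p h3.symm, h3]
    · rfl
    · rw [conjCx_conjCx]
    · omega
  · split_ifs with h1 h2 h2
    · rw [ho l p a b ha hb, if_pos h2]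
    · rw [ho l p a b ha hb, if_neg h2]
    all_goals
      rw [hX.hodgeForm_conjCx hQ (by ring)]
      have := ho l (n + l - p) b a (by rwa [hd]) (by rwa [hd])
      rw [hswap] at this
      rw [this]
      simp [h2, eq_comm (a := b)]

end Triple

end Frames

/-! ### The basis of Lefschetz strings -/

/-- Indices `(l, p, j, a)` of the vectors `N^j e l p a` of the Lefschetz strings starting in an
adapted frame with `d l p` vectors of type `(p, n + l - p)`. -/
@[ext]
structure StringIndex (d : ℕ → ℤ → ℕ) where
  l : ℕ
  p : ℤ
  j : ℕ
  a : ℕ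
  j_le : j ≤ l
  a_lt : a < d l p

section Strings

variable {U : Type u} [AddCommGroup U] [Module ℝ U]

namespace Triple

variable {n : ℕ} {Q : LinearMap.BilinForm ℝ U} {X : Triple U} {d : ℕ → ℤ → ℕ}
  {e : ℕ → ℤ → ℕ → Cx U}

/-- The vector `N^j e l p a` with index `i = (l, p, j, a)`. -/
noncomputable def stringVec (X : Triple U) (e : ℕ → ℤ → ℕ → Cx U) (i : StringIndex d) : Cx U :=
  ((X.N.baseChange ℂ) ^ i.j) (e i.l i.p i.a)

/-- The value of `Q` on two vectors of the Lefschetz strings; it depends on the indices only. -/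
noncomputable def stringGram (n : ℕ) (i k : StringIndex d) : ℂ :=
  if k.l = i.l ∧ k.p = n + i.l - i.p ∧ i.j + k.j = i.l ∧ k.a = i.a then
    (-1) ^ i.j * Complex.I ^ ((n : ℤ) + i.l - i.p - i.p) else 0

theorem IsAdaptedFrame.bilin_stringVec (he : X.IsAdaptedFrame n Q d e) (hX : X.IsPMHS n Q)
    (hS : IsRSplit X.W X.F) (hd : ∀ l p, d l (n + l - p) = d l p) (i k : StringIndex d) :
    Q.baseChange ℂ (X.stringVec e i) (X.stringVec e k) = stringGram n i k := by
  by_cases h : k.l = i.l ∧ k.p = n + i.l - i.p ∧ i.j + k.j = i.l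
  · obtain ⟨l, p, j, a, hj, ha⟩ := i
    obtain ⟨l', p', j', a', hj', ha'⟩ := k
    dsimp only at h
    obtain ⟨rfl, rfl, hjj⟩ := h
    rw [hd] at ha'
    have h1 := he.hodgeForm_eq _ _ a a' ha ha'
    rw [hodgeForm, he.conj] at h1
    simp only [stringVec, stringGram, hjj, true_and]
    rw [hX.bilin_pow_left, ← Module.End.mul_apply, ← pow_add, hjj]
    have h2 : Complex.I ^ ((n : ℤ) + l' - p - p) * Complex.I ^ (p - ((n : ℤ) + l' - p)) = 1 := by
      rw [← zpow_add₀ Complex.I_ne_zero, show (n : ℤ) + l' - p - p + (p - (n + l' - p)) = 0 by ring,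
        zpow_zero]
    rw [← one_mul (Q.baseChange ℂ _ _), ← h2, mul_assoc, h1]
    simp only [eq_comm (a := a)]
    split_ifs <;> simp
  · rw [stringGram, if_neg fun h' => h ⟨h'.1, h'.2.1, h'.2.2.1⟩]
    by_contra hne
    exact h (hX.dual_of_bilin_ne_zero hS (by ring) (by ring) (he.mem _ _ _) (he.mem _ _ _) hne)

/-- Each vector of the Lefschetz strings pairs nontrivially with exactly one other one, hence they
are linearly independent. -/
theorem IsAdaptedFrame.linearIndependent_stringVec (he : X.IsAdaptedFrame n Q d e)
    (hX : X.IsPMHS n Q) (hS : IsRSplit X.W X.F) (hd : ∀ l p, d l (n + l - p) = d l p) :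
    LinearIndependent ℂ (X.stringVec e : StringIndex d → Cx U) := by
  rw [linearIndependent_iff']
  intro s c hc i hi
  -- The index of the vector dual to `stringVec e i`.
  let i' : StringIndex d := ⟨i.l, n + i.l - i.p, i.l - i.j, i.a, Nat.sub_le _ _,
    by rw [hd]; exact i.a_lt⟩
  have h1 : Q.baseChange ℂ (∑ k ∈ s, c k • X.stringVec e k) (X.stringVec e i') = 0 := by
    rw [hc]; simp
  have hj := i.j_le
  rw [map_sum, LinearMap.sum_apply, Finset.sum_eq_single i] at h1
  · rw [map_smul, LinearMap.smul_apply, he.bilin_stringVec hX hS hd, stringGram, if_pos] at h1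
    · simpa [zpow_ne_zero _ Complex.I_ne_zero] using h1
    · exact ⟨rfl, rfl, Nat.add_sub_cancel' hj, rfl⟩
  · intro k _ hk
    rw [map_smul, LinearMap.smul_apply, he.bilin_stringVec hX hS hd, stringGram, if_neg, smul_zero]
    rintro ⟨e1, e2, e3, e4⟩
    dsimp only [i'] at e1 e2 e3 e4
    refine hk (StringIndex.ext e1.symm ?_ ?_ e4.symm)
    · rw [← e1] at e2; linarith
    · omega
  · exact fun h => absurd hi h

theorem IsAdaptedFrame.stringVec_mem (he : X.IsAdaptedFrame n Q d e) (hX : X.IsPMHS n Q)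
    (hS : IsRSplit X.W X.F) (i : StringIndex d) :
    X.stringVec e i ∈ deligneI X.W X.F (i.p - i.j) (n + i.l - i.p - i.j) :=
  hX.pow_apply_mem_deligneI hS (mem_prim.1 (he.mem _ _ _)).1 _

theorem IsAdaptedFrame.deligneI_le_span (he : X.IsAdaptedFrame n Q d e) (hX : X.IsPMHS n Q)
    (hS : IsRSplit X.W X.F) (r s : ℤ) :
    deligneI X.W X.F r s ≤ Submodule.span ℂ (X.stringVec e ''
      {i : StringIndex d | i.p - i.j = r ∧ n + i.l - i.p - i.j = s}) := by
  refine hX.deligneI_le hS (T := fun r s => Submodule.span ℂ (X.stringVec e ''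
      {i : StringIndex d | i.p - i.j = r ∧ n + i.l - i.p - i.j = s})) ?_ r s
  intro l j p q hj hpq x hx
  obtain rfl : q = n + l - p := by linarith
  have h1 := Submodule.mem_map_of_mem (f := (X.N.baseChange ℂ) ^ j) (he.prim_le l p hx)
  rw [Submodule.map_span] at h1
  refine Submodule.span_mono ?_ h1
  rintro _ ⟨_, ⟨a, ha, rfl⟩, rfl⟩
  exact ⟨⟨l, p, j, a, hj, ha⟩, ⟨rfl, rfl⟩, rfl⟩

theorem IsAdaptedFrame.top_le_span (he : X.IsAdaptedFrame n Q d e) (hX : X.IsPMHS n Q)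
    (hS : IsRSplit X.W X.F) :
    ⊤ ≤ Submodule.span ℂ (Set.range (X.stringVec e : StringIndex d → Cx U)) := by
  obtain ⟨b, hb⟩ := hX.isMHS.exists_F_eq_top
  rw [← hb]
  exact hX.isMHS.filtration_le_of_deligneI_le fun r s _ =>
    (he.deligneI_le_span hX hS r s).trans (Submodule.span_mono (Set.image_subset_range _ _))

/-- The basis of `U_ℂ` formed by the Lefschetz strings of an adapted frame. -/
noncomputable def IsAdaptedFrame.basis (he : X.IsAdaptedFrame n Q d e) (hX : X.IsPMHS n Q)
    (hS : IsRSplit X.W X.F) (hd : ∀ l p, d l (n + l - p) = d l p) :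
    Module.Basis (StringIndex d) ℂ (Cx U) :=
  Module.Basis.mk (he.linearIndependent_stringVec hX hS hd) (he.top_le_span hX hS)

@[simp] theorem IsAdaptedFrame.basis_apply (he : X.IsAdaptedFrame n Q d e) (hX : X.IsPMHS n Q)
    (hS : IsRSplit X.W X.F) (hd : ∀ l p, d l (n + l - p) = d l p) (i : StringIndex d) :
    he.basis hX hS hd i = X.stringVec e i :=
  Module.Basis.mk_apply _ _ _

theorem IsAdaptedFrame.conjCx_stringVec (he : X.IsAdaptedFrame n Q d e)
    (hd : ∀ l p, d l (n + l - p) = d l p) (i : StringIndex d) :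
    conjCx U (X.stringVec e i) =
      X.stringVec e (⟨i.l, n + i.l - i.p, i.j, i.a, i.j_le, by rw [hd]; exact i.a_lt⟩ :
        StringIndex d) := by
  rw [stringVec, conjCx_baseChange_pow, he.conj, stringVec]

theorem apply_stringVec_of_lt (i : StringIndex d) (h : i.j < i.l) :
    X.N.baseChange ℂ (X.stringVec e i) =
      X.stringVec e (⟨i.l, i.p, i.j + 1, i.a, h, i.a_lt⟩ : StringIndex d) := by
  rw [stringVec, stringVec, ← Module.End.mul_apply, ← pow_succ']

theorem IsAdaptedFrame.apply_stringVec_of_not_lt (he : X.IsAdaptedFrame n Q d e)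
    (i : StringIndex d) (h : ¬i.j < i.l) : X.N.baseChange ℂ (X.stringVec e i) = 0 := by
  have hj : i.j = i.l := le_antisymm i.j_le (not_lt.1 h)
  rw [stringVec, ← Module.End.mul_apply, ← pow_succ', hj]
  exact (mem_prim.1 (he.mem _ _ _)).2

end Triple

end Strings

/-! ### Transport between two adapted frames -/

section Transport

variable {U : Type u} [AddCommGroup U] [Module ℝ U]

/-- A complex automorphism commuting with conjugation is defined over `ℝ`. -/
theorem exists_baseChange_eq (G : Cx U ≃ₗ[ℂ] Cx U)
    (hG : ∀ x, conjCx U (G x) = G (conjCx U x)) :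
    ∃ g : U ≃ₗ[ℝ] U, ∀ x, g.toLinearMap.baseChange ℂ x = G x := by
  have hG' : ∀ x, conjCx U (G.symm x) = G.symm (conjCx U x) := fun x => by
    rw [LinearEquiv.eq_symm_apply, ← hG, LinearEquiv.apply_symm_apply]
  have hone : ∀ (H : Cx U ≃ₗ[ℂ] Cx U), (∀ x, conjCx U (H x) = H (conjCx U x)) → ∀ u : U,
      (1 : ℂ) ⊗ₜ[ℝ] reCx U (H ((1 : ℂ) ⊗ₜ u)) = H ((1 : ℂ) ⊗ₜ u) := fun H hH u =>
    one_tmul_reCx_of_conjCx_eq (by rw [hH]; simp)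
  let g : U ≃ₗ[ℝ] U := LinearEquiv.ofLinearMap
    (reCx U ∘ₗ (G.toLinearMap.restrictScalars ℝ) ∘ₗ TensorProduct.mk ℝ ℂ U 1)
    (reCx U ∘ₗ (G.symm.toLinearMap.restrictScalars ℝ) ∘ₗ TensorProduct.mk ℝ ℂ U 1)
    (by ext u; simp [hone G.symm hG']) (by ext u; simp [hone G hG])
  refine ⟨g, fun x => ?_⟩
  induction x using TensorProduct.induction_on with
  | zero => simp
  | add x y hx hy => rw [map_add, map_add, hx, hy]
  | tmul z u =>
    have h1 : z ⊗ₜ[ℝ] u = z • ((1 : ℂ) ⊗ₜ[ℝ] u) := by simp [TensorProduct.smul_tmul']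
    rw [h1, map_smul, map_smul, LinearMap.baseChange_tmul]
    exact congrArg (z • ·) (hone G hG u)

namespace Triple

variable {n : ℕ} {Q : LinearMap.BilinForm ℝ U} {X X₁ X₂ : Triple U} {d : ℕ → ℤ → ℕ}
  {e₁ e₂ : ℕ → ℤ → ℕ → Cx U}

theorem IsAdaptedFrame.map_deligneI_le (he₁ : X₁.IsAdaptedFrame n Q d e₁) (hX₁ : X₁.IsPMHS n Q)
    (hS₁ : IsRSplit X₁.W X₁.F) (he₂ : X₂.IsAdaptedFrame n Q d e₂) (hX₂ : X₂.IsPMHS n Q)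
    (hS₂ : IsRSplit X₂.W X₂.F) {G : Cx U →ₗ[ℂ] Cx U}
    (hG : ∀ i : StringIndex d, G (X₁.stringVec e₁ i) = X₂.stringVec e₂ i) (r s : ℤ) :
    deligneI X₁.W X₁.F r s ≤ (deligneI X₂.W X₂.F r s).comap G := by
  refine (he₁.deligneI_le_span hX₁ hS₁ r s).trans (Submodule.span_le.2 ?_)
  rintro _ ⟨i, ⟨rfl, rfl⟩, rfl⟩
  refine Submodule.mem_comap.2 ?_
  rw [hG]
  exact he₂.stringVec_mem hX₂ hS₂ i

theorem IsAdaptedFrame.map_F_le (he₁ : X₁.IsAdaptedFrame n Q d e₁) (hX₁ : X₁.IsPMHS n Q)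
    (hS₁ : IsRSplit X₁.W X₁.F) (he₂ : X₂.IsAdaptedFrame n Q d e₂) (hX₂ : X₂.IsPMHS n Q)
    (hS₂ : IsRSplit X₂.W X₂.F) {G : Cx U →ₗ[ℂ] Cx U}
    (hG : ∀ i : StringIndex d, G (X₁.stringVec e₁ i) = X₂.stringVec e₂ i) (p : ℤ) :
    X₁.F p ≤ (X₂.F p).comap G :=
  hX₁.isMHS.filtration_le_of_deligneI_le fun r s hr =>
    (he₁.map_deligneI_le hX₁ hS₁ he₂ hX₂ hS₂ hG r s).trans
      (Submodule.comap_mono fun _ hx => hX₂.isMHS.antitone hr hx.1.1)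

theorem IsAdaptedFrame.map_W_le (he₁ : X₁.IsAdaptedFrame n Q d e₁) (hX₁ : X₁.IsPMHS n Q)
    (hS₁ : IsRSplit X₁.W X₁.F) (he₂ : X₂.IsAdaptedFrame n Q d e₂) (hX₂ : X₂.IsPMHS n Q)
    (hS₂ : IsRSplit X₂.W X₂.F) {G : Cx U →ₗ[ℂ] Cx U}
    (hG : ∀ i : StringIndex d, G (X₁.stringVec e₁ i) = X₂.stringVec e₂ i) (l : ℤ) :
    (X₁.W l).baseChange ℂ ≤ ((X₂.W l).baseChange ℂ).comap G :=
  hX₁.isMHS.baseChange_le_of_deligneI_le fun r s hr =>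
    (he₁.map_deligneI_le hX₁ hS₁ he₂ hX₂ hS₂ hG r s).trans
      (Submodule.comap_mono fun _ hx => baseChange_mono (hX₂.isMHS.monotone hr) hx.1.2)

/-- Two `ℝ`-split PMHS with adapted frames of the same size are conjugate: the map matching the
Lefschetz strings is real, preserves `Q` and the splittings, and intertwines the nilpotents. -/
theorem exists_eq_translate (he₁ : X₁.IsAdaptedFrame n Q d e₁) (hX₁ : X₁.IsPMHS n Q)
    (hS₁ : IsRSplit X₁.W X₁.F) (he₂ : X₂.IsAdaptedFrame n Q d e₂) (hX₂ : X₂.IsPMHS n Q)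
    (hS₂ : IsRSplit X₂.W X₂.F) (hd : ∀ l p, d l (n + l - p) = d l p) :
    ∃ g ∈ autGroup Q, X₂ = X₁.translate g := by
  let b₁ := he₁.basis hX₁ hS₁ hd
  let b₂ := he₂.basis hX₂ hS₂ hd
  let G : Cx U ≃ₗ[ℂ] Cx U := b₁.equiv b₂ (Equiv.refl _)
  have hG : ∀ i : StringIndex d, G (X₁.stringVec e₁ i) = X₂.stringVec e₂ i := fun i => by
    have := b₁.equiv_apply i b₂ (Equiv.refl _)
    simpa [b₁, b₂] using this
  have hG' : ∀ i : StringIndex d, G.symm (X₂.stringVec e₂ i) = X₁.stringVec e₁ i := fun i => by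
    rw [← hG, LinearEquiv.symm_apply_apply]
  have hconj : (conjCx U).comp G.toLinearMap = G.toLinearMap.comp (conjCx U) := by
    refine b₁.ext fun i => ?_
    simp only [b₁, IsAdaptedFrame.basis_apply, LinearMap.comp_apply, LinearEquiv.coe_coe, hG,
      he₁.conjCx_stringVec hd, he₂.conjCx_stringVec hd]
  have hN : (X₂.N.baseChange ℂ) ∘ₗ G.toLinearMap = G.toLinearMap ∘ₗ (X₁.N.baseChange ℂ) := by
    refine b₁.ext fun i => ?_
    simp only [b₁, IsAdaptedFrame.basis_apply, LinearMap.comp_apply, LinearEquiv.coe_coe, hG]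
    by_cases h : i.j < i.l
    · rw [apply_stringVec_of_lt i h, apply_stringVec_of_lt i h, hG]
    · rw [he₁.apply_stringVec_of_not_lt i h, he₂.apply_stringVec_of_not_lt i h, map_zero]
  have hQ : (Q.baseChange ℂ).compl₁₂ G.toLinearMap G.toLinearMap = Q.baseChange ℂ := by
    refine LinearMap.ext_basis b₁ b₁ fun i k => ?_
    simp only [b₁, IsAdaptedFrame.basis_apply, LinearMap.compl₁₂_apply, LinearEquiv.coe_coe, hG,
      he₁.bilin_stringVec hX₁ hS₁ hd, he₂.bilin_stringVec hX₂ hS₂ hd]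
  obtain ⟨g, hg⟩ := exists_baseChange_eq G fun x => LinearMap.congr_fun hconj x
  have hgG : g.toLinearMap.baseChange ℂ = G.toLinearMap := LinearMap.ext hg
  have hg1 : ∀ u, G ((1 : ℂ) ⊗ₜ u) = (1 : ℂ) ⊗ₜ g u := fun u => by
    rw [← hg]; simp
  have hg2 : ∀ u, G.symm ((1 : ℂ) ⊗ₜ u) = (1 : ℂ) ⊗ₜ g.symm u := fun u => by
    rw [LinearEquiv.symm_apply_eq, hg1, LinearEquiv.apply_symm_apply]
  refine ⟨g, fun u v => ?_, Triple.ext ?_ ?_ ?_⟩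
  · have := LinearMap.congr_fun₂ hQ ((1 : ℂ) ⊗ₜ u) ((1 : ℂ) ⊗ₜ v)
    simpa [hg1] using this
  · funext l
    refine le_antisymm (fun u hu => ?_) ?_
    · refine ⟨g.symm u, ?_, by simp⟩
      have := he₂.map_W_le hX₂ hS₂ he₁ hX₁ hS₁ (G := G.symm.toLinearMap) hG' l
        (one_tmul_mem_baseChange_iff.2 hu)
      rw [Submodule.mem_comap, LinearEquiv.coe_coe, hg2] at this
      exact one_tmul_mem_baseChange_iff.1 this
    · rintro _ ⟨u, hu, rfl⟩
      have := he₁.map_W_le hX₁ hS₁ he₂ hX₂ hS₂ (G := G.toLinearMap) hG l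
        (one_tmul_mem_baseChange_iff.2 hu)
      rw [Submodule.mem_comap, LinearEquiv.coe_coe, hg1] at this
      exact one_tmul_mem_baseChange_iff.1 this
  · funext p
    change _ = (X₁.F p).map (g.toLinearMap.baseChange ℂ)
    rw [hgG]
    refine le_antisymm (fun x hx => ?_) ?_
    · exact ⟨G.symm x, he₂.map_F_le hX₂ hS₂ he₁ hX₁ hS₁ (G := G.symm.toLinearMap) hG' p hx,
        by simp⟩
    · exact Submodule.map_le_iff_le_comap.2
        (he₁.map_F_le hX₁ hS₁ he₂ hX₂ hS₂ (G := G.toLinearMap) hG p)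
  · ext u
    have := LinearMap.congr_fun hN ((1 : ℂ) ⊗ₜ g.symm u)
    have h2 := congrArg (reCx U) this
    simpa [hg1, translate] using h2

/-! ### The primitive sub-diamond -/

theorem primDiamond_apply {l : ℕ} (hl : l ≤ n) {p q : ℤ} (hpq : p + q = n + l) :
    X.primDiamond n p q = Module.finrank ℂ (X.prim l p q) := by
  rw [primDiamond, Finset.sum_eq_single l]
  · rw [primPart, if_pos hpq]
  · intro k _ hk
    rw [primPart, if_neg]
    omega
  · intro h
    exact absurd (Finset.mem_range.2 (by omega)) h

theorem IsPMHS.finrank_prim_eq_zero (hX : X.IsPMHS n Q) (hS : IsRSplit X.W X.F) {l : ℕ}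
    (hl : n < l) {p q : ℤ} (hpq : p + q = n + l) : Module.finrank ℂ (X.prim l p q) = 0 := by
  have : X.prim l p q = ⊥ := (Submodule.eq_bot_iff _).2 fun x hx =>
    hX.eq_zero_of_mem_deligneI_of_lt hS hpq hl (mem_prim.1 hx).1
  rw [this, finrank_bot]

theorem finrank_prim_translate {g : U ≃ₗ[ℝ] U} (hS : IsRSplit X.W X.F)
    (hS' : IsRSplit (X.translate g).W (X.translate g).F) (l : ℕ) (p q : ℤ) :
    Module.finrank ℂ ((X.translate g).prim l p q) = Module.finrank ℂ (X.prim l p q) := by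
  let G : Cx U ≃ₗ[ℂ] Cx U := g.baseChange ℝ ℂ U U
  have hG : ∀ x, G x = g.toLinearMap.baseChange ℂ x := fun x => rfl
  have hmap : ∀ (P : Submodule ℂ (Cx U)) x, G x ∈ P.map G.toLinearMap ↔ x ∈ P := fun P x => by
    rw [Submodule.mem_map_equiv, LinearEquiv.symm_apply_apply]
  have hF : ∀ r x, G x ∈ (X.translate g).F r ↔ x ∈ X.F r := fun r x =>
    hmap (X.F r) x
  have hW : ∀ r x, G x ∈ ((X.translate g).W r).baseChange ℂ ↔ x ∈ (X.W r).baseChange ℂ := by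
    intro r x
    rw [mem_baseChange_iff, mem_baseChange_iff, hG, reCx_baseChange, imCx_baseChange]
    simp [translate]
  have hNG : (X.translate g).N.baseChange ℂ ∘ₗ g.toLinearMap.baseChange ℂ =
      g.toLinearMap.baseChange ℂ ∘ₗ X.N.baseChange ℂ := by
    rw [← LinearMap.baseChange_comp, ← LinearMap.baseChange_comp]
    congr 1
    ext u
    simp [translate]
  have hN : ∀ (k : ℕ) x, (((X.translate g).N.baseChange ℂ) ^ k) (G x) =
      G (((X.N.baseChange ℂ) ^ k) x) := by
    intro k x
    induction k with
    | zero => rfl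
    | succ k ih =>
      rw [pow_succ', Module.End.mul_apply, ih, pow_succ', Module.End.mul_apply]
      exact LinearMap.congr_fun hNG _
  have h : (X.translate g).prim l p q = (X.prim l p q).map G.toLinearMap := by
    ext y
    obtain ⟨x, rfl⟩ := G.surjective y
    rw [hmap, mem_prim, mem_prim, hS.mem_deligneI, hS'.mem_deligneI, hN, hG, conjCx_baseChange,
      ← hG, ← hG, hF, hF, hW, LinearEquiv.map_eq_zero_iff]
  rw [h]
  exact LinearEquiv.finrank_map_eq G _

end Triple

end Transport

end HodgeDiamond

theorem corollary4p6 {V : Type*} [AddCommGroup V] [Module ℚ V] [Module.Finite ℚ V]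
    (n : ℕ) (Q : LinearMap.BilinForm ℚ V) (hQ : Q.Nondegenerate)
    (hQn : ∀ u v, Q u v = (-1) ^ n * Q v u) (h : ℤ → ℤ → ℕ)
    (X₁ X₂ : HodgeDiamond.Triple (ℝ ⊗[ℚ] V))
    (hX₁ : X₁.IsRSplitPMHSOn n (Q.baseChange ℝ) h)
    (hX₂ : X₂.IsRSplitPMHSOn n (Q.baseChange ℝ) h) :
    (∃ g ∈ HodgeDiamond.autGroup (Q.baseChange ℝ), X₂ = X₁.translate g) ↔
      X₁.primDiamond n = X₂.primDiamond n := by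
  constructor
  · rintro ⟨g, -, rfl⟩
    funext p q
    refine Finset.sum_congr rfl fun l _ => ?_
    rw [HodgeDiamond.Triple.primPart, HodgeDiamond.Triple.primPart,
      HodgeDiamond.Triple.finrank_prim_translate hX₁.isRSplit hX₂.isRSplit]
  · intro heq
    have hsymm : ∀ u v, Q.baseChange ℝ u v = (-1) ^ n * Q.baseChange ℝ v u := by
      intro x y
      induction x using TensorProduct.induction_on with
      | zero => simp
      | add x x' hx hx' => simp only [map_add, LinearMap.add_apply, hx, hx']; ring
      | tmul z u =>
        induction y using TensorProduct.induction_on with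
        | zero => simp
        | tmul z' u' =>
          simp only [LinearMap.BilinForm.baseChange_tmul, hQn u u', Rat.smul_def]
          push_cast; ring
        | add y y' hy hy' => simp only [map_add, LinearMap.add_apply, hy, hy']; ring
    obtain ⟨e₁, he₁⟩ := hX₁.isPMHS.exists_isAdaptedFrame hX₁.isRSplit hsymm
    obtain ⟨e₂, he₂⟩ := hX₂.isPMHS.exists_isAdaptedFrame hX₂.isRSplit hsymm
    have hdim : ∀ (l : ℕ) (p : ℤ), Module.finrank ℂ (X₁.prim l p (n + l - p)) =
        Module.finrank ℂ (X₂.prim l p (n + l - p)) := by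
      intro l p
      have hpq : p + (n + l - p) = n + l := by ring
      rcases le_or_gt l n with hl | hl
      · rw [← HodgeDiamond.Triple.primDiamond_apply hl hpq, heq,
          HodgeDiamond.Triple.primDiamond_apply hl hpq]
      · rw [hX₁.isPMHS.finrank_prim_eq_zero hX₁.isRSplit hl hpq,
          hX₂.isPMHS.finrank_prim_eq_zero hX₂.isRSplit hl hpq]
    simp only [← hdim] at he₂
    refine HodgeDiamond.Triple.exists_eq_translate he₁ hX₁.isPMHS hX₁.isRSplit he₂ hX₂.isPMHS
      hX₂.isRSplit fun l p => ?_
    rw [show (n : ℤ) + l - (n + l - p) = p by ring,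
      HodgeDiamond.Triple.finrank_prim_swap hX₁.isRSplit]
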